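/- We work in $\mathbb{P}^3=\mathbb{P}^3_{\mathbb{C}}$ with coordinates $x,y,z,w$. A finite set $Z\subset\mathbb{P}^3$ is \emph{$(a,b)$-geproci} ($a\le b$) if its projection from a general point to a plane is a complete intersection of plane curves of degrees $a$ and $b$, i.e. the homogeneous ideal of the projected set is generated by a form of degree $a$ and a form of degree $b$. A \emph{$(c,d)$-grid} ($2\le c\le d$) is a set $A\cap B$, where $A$ is a union of $c$ pairwise disjoint lines, $B$ is a union of $d$ pairwise disjoint lines, and each line of $A$ meets each line of $B$ in exactly one point. A geproci set is \emph{nontrivial} if it is not contained in a plane and is not a $(c,d)$-grid for any $c,d$. Finite sets $Z_1,Z_2\subset\mathbb{P}^3$ are \emph{combinatorially equivalent} if there is a bijection $f\colon Z_1\to Z_2$ such that, for every $S\subseteq Z_1$, $f$ induces a bijection from $\langle S\rangle\cap Z_1$ to $\langle f(S)\rangle\cap Z_2$ (linear spans); they are \emph{projectively equivalent} if a linear automorphism of $\mathbb{P}^3$ takes $Z_1$ to $Z_2$. For $n\ge 3$ let $X_n=\{[1:t:s:st] : s^n=t^n=1\}$ and $Y_n=\{[1:0:0:-s] : s^n=1\}$,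 and for $t^n=1$ let $L_t$ be the line $tx=y,\ tz=w$. The standard construction is $X_n\cup Y_n$; the extended construction is $X_n\cup Y_n\cup\{[1:0:0:0]\}\cup\{[1:t:0:0] : t^n=1\}$. \textbf{Corollary.} For all integers $4\le a\le b$ there are two nontrivial $(a,b)$-geproci sets $Z_1,Z_2\subset\mathbb{P}^3$ such that $Z_1$ is obtained from the standard construction with $n=b$ by removing the points on $b+1-a$ of the lines $L_t$ ($t^b=1$), and $Z_2$ is obtained from the extended construction with $n=b-1$ by removing the points on $b-a$ of the lines $L_t$ ($t^{b-1}=1$), with the following properties. (i) If $a<b$, then no line contains exactly $a$ points of $Z_1$ and exactly $a$ lines contain exactly $b$ points of $Z_1$, while exactly one line contains exactly $a$ points of $Z_2$ and exactly $a$ lines contain exactly $b$ points of $Z_2$. (ii) If $a=b$, then exactly $b$ lines contain exactly $b$ points of $Z_1$, while exactly $b+1$ lines contain exactly $b$ points of $Z_2$. (iii) $Z_1$ and $Z_2$ are not combinatorially equivalent, and they are not projectively equivalent. -/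

import Mathlib

open scoped LinearAlgebra.Projectivization

namespace Geproci

/-- The projective space `ℙ³` over the complex numbers. -/
abbrev P3 : Type := ℙ ℂ (Fin 4 → ℂ)

/-- The projective plane `ℙ²` over the complex numbers. -/
abbrev P2 : Type := ℙ ℂ (Fin 3 → ℂ)

/-- The homogeneous ideal `I(S)` of a set `S` of points of the projective plane: the polynomials
that vanish on the affine cone over `S`. -/
noncomputable def idealOf (S : Set P2) : Ideal (MvPolynomial (Fin 3) ℂ) :=
  MvPolynomial.vanishingIdeal ℂ {x : Fin 3 → ℂ | ∃ q ∈ S, x ∈ q.submodule}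

/-- `S ⊆ ℙ²` is the (reduced) complete intersection of a curve of degree `a` and a curve of
degree `b`: its homogeneous ideal is generated by a form of degree `a` and a form of degree `b`. -/
def IsPlaneCI (a b : ℕ) (S : Set P2) : Prop :=
  ∃ F G : MvPolynomial (Fin 3) ℂ, F.IsHomogeneous a ∧ G.IsHomogeneous b ∧
    idealOf S = Ideal.span {F, G}

/-- A property holds for a general point of `ℙ³`: it holds on a nonempty Zariski open subset
(every such subset contains the complement of a hypersurface). -/
def ForGeneralPoint (Q : P3 → Prop) : Prop :=
  ∃ (d : ℕ) (F : MvPolynomial (Fin 4) ℂ), F ≠ 0 ∧ F.IsHomogeneous d ∧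
    ∀ P : P3, MvPolynomial.eval P.rep F ≠ 0 → Q P

/-- The linear map `φ : ℂ⁴ → ℂ³` induces the projection of `ℙ³` from the point `P`. Each plane
`H ∌ P` with linear coordinates on it gives such a `φ` (projection from `P` to `H`), and
conversely; two of them differ by a linear change of coordinates. -/
def IsProjectionFrom (P : P3) (φ : (Fin 4 → ℂ) →ₗ[ℂ] (Fin 3 → ℂ)) : Prop :=
  LinearMap.ker φ = P.submodule

/-- The image of `Z` under the projection induced by `φ`. -/
def projImage (φ : (Fin 4 → ℂ) →ₗ[ℂ] (Fin 3 → ℂ)) (Z : Set P3) : Set P2 :=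
  {q | ∃ p ∈ Z, q.submodule = p.submodule.map φ}

/-- `Z` is an `(a,b)`-geproci set: a finite set whose projection from a general point to a plane
is a complete intersection of plane curves of degrees `a ≤ b`. -/
def IsGeproci (a b : ℕ) (Z : Set P3) : Prop :=
  Z.Finite ∧ a ≤ b ∧
    ForGeneralPoint fun P => P ∉ Z ∧ ∀ φ, IsProjectionFrom P φ → IsPlaneCI a b (projImage φ Z)

/-- A submodule `W` of `ℂ⁴` of dimension 2 is a line of `ℙ³`. -/
def IsLine (W : Submodule ℂ (Fin 4 → ℂ)) : Prop := Module.finrank ℂ W = 2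

/-- The points of the projective linear subspace given by `W`. -/
def pointsOf (W : Submodule ℂ (Fin 4 → ℂ)) : Set P3 := {p | p.submodule ≤ W}

/-- `Z` is an `(a,b)`-grid: the intersection of a union of `a ≥ 2` pairwise disjoint lines with a
union of `b ≥ a` pairwise disjoint lines, where each line of the first kind meets each line of the
second kind in exactly one point. -/
def IsGrid (a b : ℕ) (Z : Set P3) : Prop :=
  2 ≤ a ∧ a ≤ b ∧ ∃ (A : Fin a → Submodule ℂ (Fin 4 → ℂ)) (B : Fin b → Submodule ℂ (Fin 4 → ℂ)),
    (∀ i, IsLine (A i)) ∧ (∀ j, IsLine (B j)) ∧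
    (∀ i i', i ≠ i' → Disjoint (pointsOf (A i)) (pointsOf (A i'))) ∧
    (∀ j j', j ≠ j' → Disjoint (pointsOf (B j)) (pointsOf (B j'))) ∧
    (∀ i j, ∃! p, p ∈ pointsOf (A i) ∩ pointsOf (B j)) ∧
    Z = (⋃ i, pointsOf (A i)) ∩ ⋃ j, pointsOf (B j)

/-- `Z` is nondegenerate: it is not contained in a plane. -/
def Nondegenerate (Z : Set P3) : Prop :=
  ∀ W : Submodule ℂ (Fin 4 → ℂ), Module.finrank ℂ W = 3 → ¬ Z ⊆ pointsOf W

/-- `Z` is a nontrivial `(a,b)`-geproci set: it is nondegenerate and not a grid. -/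
def IsNontrivialGeproci (a b : ℕ) (Z : Set P3) : Prop :=
  IsGeproci a b Z ∧ Nondegenerate Z ∧ ∀ c d, ¬ IsGrid c d Z

/-- Combinatorial equivalence: there is a bijection `f : Z₁ → Z₂` such that, for every `S ⊆ Z₁`,
`f` induces a bijection from `⟨S⟩ ∩ Z₁` to `⟨f(S)⟩ ∩ Z₂`, with `⟨·⟩` the linear span. -/
def CombEquiv (Z₁ Z₂ : Set P3) : Prop :=
  ∃ f : P3 → P3, Set.BijOn f Z₁ Z₂ ∧ ∀ S ⊆ Z₁,
    Set.BijOn f ((Projectivization.Subspace.span S : Set P3) ∩ Z₁)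
      ((Projectivization.Subspace.span (f '' S) : Set P3) ∩ Z₂)

/-- Projective equivalence: some linear automorphism of `ℙ³` takes `Z₁` to `Z₂`. -/
def ProjEquiv (Z₁ Z₂ : Set P3) : Prop :=
  ∃ g : (Fin 4 → ℂ) ≃ₗ[ℂ] (Fin 4 → ℂ),
    Projectivization.map g.toLinearMap g.injective '' Z₁ = Z₂

/-- The number of lines that contain exactly `k` points of `Z` (meaningful for `2 ≤ k`). -/
noncomputable def numLines (Z : Set P3) (k : ℕ) : ℕ∞ :=
  {W : Submodule ℂ (Fin 4 → ℂ) | IsLine W ∧ (Z ∩ pointsOf W).encard = k}.encard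

/-- The point `[1 : y : z : w]`. -/
noncomputable def pt (y z w : ℂ) : P3 :=
  Projectivization.mk ℂ ![1, y, z, w] (fun h => one_ne_zero (congrFun h 0))

/-- The grid `X` on the quadric `xw = yz`: the Segre products of the points `[1 : s]` and
`[1 : t]`, for `s` and `t` the `n`-th roots of unity. -/
noncomputable def gridX (n : ℕ) : Set P3 :=
  {p | ∃ s t : ℂ, s ^ n = 1 ∧ t ^ n = 1 ∧ p = pt t s (s * t)}

/-- The set `Y₁` of the `n` points `[1 : 0 : 0 : -s]` with `s ^ n = 1`, on the line `y = z = 0`. -/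
noncomputable def collinearY (n : ℕ) : Set P3 :=
  {p | ∃ s : ℂ, s ^ n = 1 ∧ p = pt 0 0 (-s)}

/-- The line `t x = y`, `t z = w`. For `t ^ n = 1` these are the grid lines of one ruling. -/
def lineL (t : ℂ) : Submodule ℂ (Fin 4 → ℂ) := Submodule.span ℂ {![1, t, 0, 0], ![0, 0, 1, t]}

/-- The standard construction: the `(n,n+1)`-geproci set `X ∪ Y₁`. -/
noncomputable def standardSet (n : ℕ) : Set P3 := gridX n ∪ collinearY n

/-- The extended construction: to `X ∪ Y₁` one adds the point `Q = [1 : 0 : 0 : 0]`, where the line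
of `Y₁` meets the quadric `xw = yz`, and the `n` points `[1 : t : 0 : 0]` in which the line
`z = w = 0` of the quadric through `Q` meets the grid lines `lineL t`, `t ^ n = 1`. -/
noncomputable def extendedSet (n : ℕ) : Set P3 :=
  standardSet n ∪ {p | p = pt 0 0 0 ∨ ∃ t : ℂ, t ^ n = 1 ∧ p = pt t 0 0}

/-- `Z` is obtained from `S` by removing the points on `k` of the grid lines `lineL t`,
`t ^ n = 1`. -/
def RemoveGridLines (n k : ℕ) (S Z : Set P3) : Prop :=
  ∃ R : Finset ℂ, R.card = k ∧ (∀ t ∈ R, t ^ n = 1) ∧ Z = S \ ⋃ t ∈ R, pointsOf (lineL t)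

/-- `Z` is an `(a,b)`-set of the standard construction: the set `X ∪ Y₁` for `n = b` without the
points on `b + 1 - a` grid lines of one ruling. -/
def FromStandardConstruction (a b : ℕ) (Z : Set P3) : Prop :=
  RemoveGridLines b (b + 1 - a) (standardSet b) Z

/-- `Z` is an `(a,b)`-set of the extended construction: the `(b,b)`-set that extends `X ∪ Y₁` for
`n = b - 1`, without the points on `b - a` of the `b - 1` grid lines of the ruling `lineL`. -/
def FromExtendedConstruction (a b : ℕ) (Z : Set P3) : Prop :=
  RemoveGridLines (b - 1) (b - a) (extendedSet (b - 1)) Z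

end Geproci

/-! Both sets have the form `unionSet T S`: there are a = |T| + 1 pairwise skew lines, namely `lineL
t` for t ∈ T and y = z = 0, and each carries |S| = b points. For Z₁, S is the set of b-th roots of
unity. For Z₂, it is the set of (b-1)-th roots together with 0, the parameter 0 giving exactly the
points added in the extended construction.

Projection from a general point p turns the a lines into a product F of a linear forms. The form G
of degree b comes from the quadric xw = yz. Let n be the order of the roots of unity. The planes
joining p to all n lines `lineL t` have a product that vanishes on the grid, and so do the planes
joining p to the n lines `lineM s` of the other ruling. At the points of Y_n the two products agree
(`prod_planeM_vec_none`), so their difference vanishes on the whole standard construction. For Z₂ it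
is multiplied by the plane joining p to `lineM 0`. For general p, G vanishes identically on no
component of F, and each component carries exactly deg G of the points, so F and G generate the
ideal. This is shown by peeling off one line at a time (`mem_span_prod_linForm`).

The two sets are told apart by counting lines. A line with at least four points is one of the a
lines above or lies in the other ruling (`eq_gridLine_or_lineM`). The former carry b points, `lineM
s` with s ≠ 0 carries a - 1, and `lineM 0`, relevant for Z₂ only, carries a. Hence Z₂ has more lines
with exactly a points than Z₁: 1 against 0 if a < b, and b + 1 against b if a = b. Either kind of
equivalence would forbid this. -/

namespace Geproci

/-! ### Linear forms and homogeneous components -/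

/-- The linear form, as a polynomial, of a linear functional. -/
noncomputable def linForm {n : ℕ} (f : (Fin n → ℂ) →ₗ[ℂ] ℂ) : MvPolynomial (Fin n) ℂ :=
  ∑ i, MvPolynomial.C (f (Pi.single i 1)) * MvPolynomial.X i

@[simp]
lemma eval_linForm {n : ℕ} (f : (Fin n → ℂ) →ₗ[ℂ] ℂ) (x : Fin n → ℂ) :
    MvPolynomial.eval x (linForm f) = f x := by
  conv_rhs => rw [pi_eq_sum_univ' x]
  simp [linForm, mul_comm]

lemma isHomogeneous_linForm {n : ℕ} (f : (Fin n → ℂ) →ₗ[ℂ] ℂ) : (linForm f).IsHomogeneous 1 :=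
  MvPolynomial.IsHomogeneous.sum _ _ _ fun i _ => MvPolynomial.isHomogeneous_C_mul_X _ i

lemma isHomogeneous_prod_linForm {n : ℕ} {ι : Type*} (s : Finset ι)
    (f : ι → (Fin n → ℂ) →ₗ[ℂ] ℂ) : (∏ i ∈ s, linForm (f i)).IsHomogeneous s.card := by
  simpa using MvPolynomial.IsHomogeneous.prod s (fun i => linForm (f i)) (fun _ => 1)
    fun i _ => isHomogeneous_linForm (f i)

lemma linForm_ne_zero {n : ℕ} {f : (Fin n → ℂ) →ₗ[ℂ] ℂ} (hf : f ≠ 0) : linForm f ≠ 0 := by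
  intro h
  apply hf
  ext x
  simp [← eval_linForm f, h]

lemma eval_smul_of_isHomogeneous {n m : ℕ} {p : MvPolynomial (Fin n) ℂ} (hp : p.IsHomogeneous m)
    (c : ℂ) (x : Fin n → ℂ) :
    MvPolynomial.eval (c • x) p = c ^ m * MvPolynomial.eval x p := by
  rw [MvPolynomial.eval_eq', MvPolynomial.eval_eq', Finset.mul_sum]
  refine Finset.sum_congr rfl fun d hd => ?_
  have h : ∑ i, d i = m := by
    rw [hp.degree_eq_sum_deg_support hd]
    exact (Finset.sum_subset (Finset.subset_univ _) (by simp)).symm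
  simp only [Pi.smul_apply, smul_eq_mul, mul_pow, Finset.prod_mul_distrib]
  rw [Finset.prod_pow_eq_pow_sum, h]
  ring

lemma homogeneousComponent_mul_of_isHomogeneous {n m : ℕ} {p : MvPolynomial (Fin n) ℂ}
    (hp : p.IsHomogeneous m) (q : MvPolynomial (Fin n) ℂ) (k : ℕ) :
    MvPolynomial.homogeneousComponent (m + k) (p * q) =
      p * MvPolynomial.homogeneousComponent k q := by
  conv_lhs => rw [← MvPolynomial.sum_homogeneousComponent q, Finset.mul_sum, map_sum]
  have h : ∀ i, MvPolynomial.homogeneousComponent (m + k)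
      (p * MvPolynomial.homogeneousComponent i q) =
      if k = i then p * MvPolynomial.homogeneousComponent i q else 0 := by
    intro i
    rw [MvPolynomial.homogeneousComponent_of_mem
      (hp.mul (MvPolynomial.homogeneousComponent_isHomogeneous i q))]
    simp
  simp only [h, Finset.sum_ite_eq, Finset.mem_range]
  split_ifs with hk
  · rfl
  · rw [MvPolynomial.homogeneousComponent_eq_zero k q (by omega), mul_zero]

/-! ### Ideals of points lying on lines of the plane -/

/-- The ideal of a point of the plane is generated by two linear forms. -/
lemma mem_span_pair_of_vanish {v : Fin 3 → ℂ} (hv : v ≠ 0) {l m : (Fin 3 → ℂ) →ₗ[ℂ] ℂ}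
    (hlm : ∀ x, l x = 0 → m x = 0 → ∃ c : ℂ, x = c • v)
    {H : MvPolynomial (Fin 3) ℂ} (hH : ∀ c : ℂ, c ≠ 0 → MvPolynomial.eval (c • v) H = 0) :
    H ∈ Ideal.span {linForm l, linForm m} := by
  obtain ⟨i₀, hi₀⟩ : ∃ i, v i ≠ 0 := Function.ne_iff.mp hv
  -- With κ(v) = 1, each variable X_i is congruent to v_i κ modulo the ideal. So H becomes q(κ) for
  -- the one-variable polynomial q(c) = H(c v).
  set κ : (Fin 3 → ℂ) →ₗ[ℂ] ℂ := (v i₀)⁻¹ • LinearMap.proj i₀ with hκ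
  have hκv : κ v = 1 := by simp [hκ, hi₀]
  set I : Ideal (MvPolynomial (Fin 3) ℂ) := Ideal.span {linForm l, linForm m} with hI
  have key : ∀ i, (MvPolynomial.X i : MvPolynomial (Fin 3) ℂ) -
      MvPolynomial.C (v i) * linForm κ ∈ I := by
    intro i
    have h1 : (LinearMap.proj i - v i • κ : (Fin 3 → ℂ) →ₗ[ℂ] ℂ) ∈
        Submodule.span ℂ (Set.range ![l, m]) := by
      apply mem_span_of_iInf_ker_le_ker
      intro x hx
      simp only [Submodule.mem_iInf, LinearMap.mem_ker] at hx
      obtain ⟨c, rfl⟩ := hlm x (hx 0) (hx 1)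
      simp [hκv]
    simp only [Matrix.range_cons, Matrix.range_empty, Set.union_empty,
      Set.singleton_union] at h1
    obtain ⟨c, d, hcd⟩ := Submodule.mem_span_pair.mp h1
    have h2 : (MvPolynomial.X i : MvPolynomial (Fin 3) ℂ) - MvPolynomial.C (v i) * linForm κ =
        MvPolynomial.C c * linForm l + MvPolynomial.C d * linForm m := by
      apply MvPolynomial.funext
      intro x
      simpa using (congrArg (fun f => f x) hcd).symm
    rw [h2]
    exact Ideal.mem_span_pair.mpr ⟨_, _, rfl⟩
  set q : Polynomial ℂ :=
    MvPolynomial.aeval (fun i => Polynomial.C (v i) * Polynomial.X) H with hq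
  have hqe : ∀ c, q.eval c = MvPolynomial.eval (c • v) H := by
    intro c
    rw [hq, ← Polynomial.coe_evalRingHom, MvPolynomial.aeval_def, MvPolynomial.hom_eval₂,
      MvPolynomial.eval, MvPolynomial.coe_eval₂Hom]
    have h1 : (Polynomial.evalRingHom c).comp (algebraMap ℂ (Polynomial ℂ)) = RingHom.id ℂ :=
      RingHom.ext fun _ => Polynomial.eval_C
    have h2 : (fun i => (Polynomial.evalRingHom c) (Polynomial.C (v i) * Polynomial.X)) =
        c • v := by
      funext i
      simp only [map_mul, Polynomial.coe_evalRingHom, Polynomial.eval_C, Polynomial.eval_X,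
        Pi.smul_apply, smul_eq_mul]
      exact mul_comm _ _
    rw [h1, h2]
  have hq0 : q = 0 := by
    -- Vanishing is not assumed at c = 0: the cofactors to which the lemma is applied in inductions
    -- are only known to vanish off the vertex of the cone. The factor X absorbs this value.
    have : Polynomial.X * q = 0 := by
      apply Polynomial.funext
      intro c
      by_cases hc : c = 0
      · simp [hc]
      · simp [hqe, hH c hc]
    exact (mul_eq_zero.mp this).resolve_left Polynomial.X_ne_zero
  rw [← Ideal.Quotient.eq_zero_iff_mem]
  have h3 : (Ideal.Quotient.mkₐ ℂ I) H =
      Polynomial.aeval (Ideal.Quotient.mkₐ ℂ I (linForm κ)) q := by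
    have : (Ideal.Quotient.mkₐ ℂ I) = ((Polynomial.aeval (Ideal.Quotient.mkₐ ℂ I (linForm κ))).comp
        (MvPolynomial.aeval (fun i => Polynomial.C (v i) * Polynomial.X))) := by
      apply MvPolynomial.algHom_ext
      intro i
      have := (Ideal.Quotient.mk_eq_mk_iff_sub_mem _ _).mpr (key i)
      simp only [AlgHom.comp_apply, MvPolynomial.aeval_X, map_mul, Polynomial.aeval_X,
        Ideal.Quotient.mkₐ_eq_mk, Polynomial.aeval_C]
      rw [this, map_mul]
      rfl
    exact congrArg (fun f => f H) this
  rw [hq0, map_zero] at h3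
  exact h3

/-- The ideal of finitely many points of a line of the plane. -/
lemma mem_span_linForm_prod {ι : Type*} [DecidableEq ι] {l : (Fin 3 → ℂ) →ₗ[ℂ] ℂ}
    {m : ι → (Fin 3 → ℂ) →ₗ[ℂ] ℂ} {v : ι → Fin 3 → ℂ} (S : Finset ι)
    (hv : ∀ j ∈ S, v j ≠ 0)
    (hlm : ∀ j ∈ S, ∀ x, l x = 0 → m j x = 0 → ∃ c : ℂ, x = c • v j)
    (hl : ∀ j ∈ S, l (v j) = 0)
    (hne : ∀ j ∈ S, ∀ k ∈ S, j ≠ k → m j (v k) ≠ 0) (H : MvPolynomial (Fin 3) ℂ)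
    (hH : ∀ j ∈ S, ∀ c : ℂ, c ≠ 0 → MvPolynomial.eval (c • v j) H = 0) :
    H ∈ Ideal.span {linForm l, ∏ j ∈ S, linForm (m j)} := by
  induction S using Finset.induction_on generalizing H with
  | empty => exact Ideal.mem_span_pair.mpr ⟨0, H, by simp⟩
  | insert j S hj ih =>
    have hjS := Finset.mem_insert_self j S
    obtain ⟨A, B, hAB⟩ := Ideal.mem_span_pair.mp (mem_span_pair_of_vanish (hv j hjS) (hlm j hjS)
      (hH j hjS))
    have hmem : ∀ k ∈ S, k ∈ insert j S := fun k hk => Finset.mem_insert_of_mem hk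
    obtain ⟨A', B', hAB'⟩ := Ideal.mem_span_pair.mp (ih (fun k hk => hv k (hmem k hk))
      (fun k hk => hlm k (hmem k hk)) (fun k hk => hl k (hmem k hk))
      (fun k hk k' hk' => hne k (hmem k hk) k' (hmem k' hk')) B (by
        intro k hk c hc
        have h := hH k (hmem k hk) c hc
        rw [← hAB] at h
        have hjk : j ≠ k := fun h => hj (h ▸ hk)
        simpa [hl k (hmem k hk), hc, hne j hjS k (hmem k hk) hjk] using h))
    refine Ideal.mem_span_pair.mpr ⟨A + A' * linForm (m j), B', ?_⟩
    rw [Finset.prod_insert hj, ← hAB, ← hAB']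
    ring

/-- A form of degree `#S` that vanishes at the points `v j` of a line but not on the line cuts
out exactly these points. -/
lemma prod_mem_span_linForm {ι : Type*} [DecidableEq ι] {l : (Fin 3 → ℂ) →ₗ[ℂ] ℂ}
    {m : ι → (Fin 3 → ℂ) →ₗ[ℂ] ℂ} {v : ι → Fin 3 → ℂ} {S : Finset ι} (hS : S.Nonempty)
    (hv : ∀ j ∈ S, v j ≠ 0)
    (hlm : ∀ j ∈ S, ∀ x, l x = 0 → m j x = 0 → ∃ c : ℂ, x = c • v j)
    (hl : ∀ j ∈ S, l (v j) = 0)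
    (hne : ∀ j ∈ S, ∀ k ∈ S, j ≠ k → m j (v k) ≠ 0) {G : MvPolynomial (Fin 3) ℂ}
    (hG : G.IsHomogeneous S.card) (hGv : ∀ j ∈ S, MvPolynomial.eval (v j) G = 0)
    (hGl : ∃ x, l x = 0 ∧ MvPolynomial.eval x G ≠ 0) :
    ∏ j ∈ S, linForm (m j) ∈ Ideal.span {linForm l, G} := by
  have hGc : ∀ j ∈ S, ∀ c : ℂ, c ≠ 0 → MvPolynomial.eval (c • v j) G = 0 := by
    intro j hj c _
    rw [eval_smul_of_isHomogeneous hG, hGv j hj, mul_zero]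
  obtain ⟨A, B, hAB⟩ := Ideal.mem_span_pair.mp
    (mem_span_linForm_prod S hv hlm hl hne G hGc)
  -- In degree |S| only the constant term d of B survives, so G is d times the product plus a
  -- multiple of l. If d were 0, G would vanish on the whole line.
  have h1 := congrArg (MvPolynomial.homogeneousComponent S.card) hAB
  rw [MvPolynomial.homogeneousComponent_of_mem hG, if_pos rfl, map_add, mul_comm B,
    mul_comm A] at h1
  have h2 := homogeneousComponent_mul_of_isHomogeneous (isHomogeneous_prod_linForm S m) B 0
  have h3 := homogeneousComponent_mul_of_isHomogeneous (isHomogeneous_linForm l) A (S.card - 1)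
  rw [Nat.add_sub_cancel' hS.card_pos] at h3
  rw [add_zero] at h2
  rw [h2, h3, MvPolynomial.homogeneousComponent_zero] at h1
  set d := MvPolynomial.coeff 0 B
  have hd : d ≠ 0 := by
    intro hd
    obtain ⟨x, hx, hGx⟩ := hGl
    apply hGx
    rw [← h1, hd]
    simp [hx]
  refine Ideal.mem_span_pair.mpr
    ⟨-MvPolynomial.C d⁻¹ * MvPolynomial.homogeneousComponent (S.card - 1) A,
      MvPolynomial.C d⁻¹, ?_⟩
  have hdd : (MvPolynomial.C d⁻¹ : MvPolynomial (Fin 3) ℂ) * MvPolynomial.C d = 1 := by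
    rw [← MvPolynomial.C_mul, inv_mul_cancel₀ hd, MvPolynomial.C_1]
  linear_combination (-MvPolynomial.C d⁻¹) * h1 + (∏ j ∈ S, linForm (m j)) * hdd

/-- Points on a union of lines, cut out on each line by a form of degree the number of points on
it, form a complete intersection. -/
lemma mem_span_prod_linForm {κ ι : Type*} [DecidableEq κ] [DecidableEq ι]
    {l : κ → (Fin 3 → ℂ) →ₗ[ℂ] ℂ}
    {m : κ → ι → (Fin 3 → ℂ) →ₗ[ℂ] ℂ} {v : κ → ι → Fin 3 → ℂ} {S : Finset ι} (hS : S.Nonempty)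
    (I : Finset κ)
    (hv : ∀ i ∈ I, ∀ j ∈ S, v i j ≠ 0)
    (hlm : ∀ i ∈ I, ∀ j ∈ S, ∀ x, l i x = 0 → m i j x = 0 → ∃ c : ℂ, x = c • v i j)
    (hl : ∀ i ∈ I, ∀ j ∈ S, l i (v i j) = 0)
    (hne : ∀ i ∈ I, ∀ j ∈ S, ∀ k ∈ S, j ≠ k → m i j (v i k) ≠ 0)
    (hlne : ∀ i ∈ I, ∀ i' ∈ I, i ≠ i' → ∀ j ∈ S, l i (v i' j) ≠ 0)
    {G : MvPolynomial (Fin 3) ℂ}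
    (hG : G.IsHomogeneous S.card) (hGv : ∀ i ∈ I, ∀ j ∈ S, MvPolynomial.eval (v i j) G = 0)
    (hGl : ∀ i ∈ I, ∃ x, l i x = 0 ∧ MvPolynomial.eval x G ≠ 0) (H : MvPolynomial (Fin 3) ℂ)
    (hH : ∀ i ∈ I, ∀ j ∈ S, ∀ c : ℂ, c ≠ 0 → MvPolynomial.eval (c • v i j) H = 0) :
    H ∈ Ideal.span {∏ i ∈ I, linForm (l i), G} := by
  induction I using Finset.induction_on generalizing H with
  | empty => exact Ideal.mem_span_pair.mpr ⟨H, 0, by simp⟩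
  | insert i I hi ih =>
    have hiI := Finset.mem_insert_self i I
    have hmem : ∀ k ∈ I, k ∈ insert i I := fun k hk => Finset.mem_insert_of_mem hk
    obtain ⟨A, B, hAB⟩ := Ideal.mem_span_pair.mp
      (mem_span_linForm_prod S (hv i hiI) (hlm i hiI) (hl i hiI) (hne i hiI) H
        (hH i hiI))
    obtain ⟨C, D, hCD⟩ := Ideal.mem_span_pair.mp
      (prod_mem_span_linForm hS (hv i hiI) (hlm i hiI) (hl i hiI) (hne i hiI) hG
        (hGv i hiI) (hGl i hiI))
    -- Modulo l_i the product of the m_{ij} is a multiple of G, so H is a multiple of l_i plus a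
    -- multiple of G. At the points of the other lines G vanishes and l_i does not. The cofactor of
    -- l_i therefore vanishes there, and the induction hypothesis applies to it.
    have hHE : (A + B * C) * linForm (l i) + B * D * G = H := by
      rw [← hAB, ← hCD]
      ring
    obtain ⟨A', B', hAB'⟩ := Ideal.mem_span_pair.mp (ih (fun k hk => hv k (hmem k hk))
      (fun k hk => hlm k (hmem k hk)) (fun k hk => hl k (hmem k hk))
      (fun k hk => hne k (hmem k hk))
      (fun k hk k' hk' => hlne k (hmem k hk) k' (hmem k' hk'))
      (fun k hk => hGv k (hmem k hk)) (fun k hk => hGl k (hmem k hk)) (A + B * C) (by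
        intro k hk j hj c hc
        have h := hH k (hmem k hk) j hj c hc
        have hik : i ≠ k := fun h => hi (h ▸ hk)
        have hg : MvPolynomial.eval (c • v k j) G = 0 := by
          rw [eval_smul_of_isHomogeneous hG, hGv k (hmem k hk) j hj, mul_zero]
        rw [← hHE, map_add, map_mul, map_mul, hg, mul_zero, add_zero, eval_linForm, map_smul,
          smul_eq_mul] at h
        exact (mul_eq_zero.mp h).resolve_right
          (mul_ne_zero hc (hlne i hiI k (hmem k hk) hik j hj))))
    refine Ideal.mem_span_pair.mpr ⟨A', B' * linForm (l i) + B * D, ?_⟩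
    rw [Finset.prod_insert hi, ← hHE, ← hAB']
    ring

/-! ### Coordinates, and planes through the centre of projection -/

/-- Homogeneous coordinates of the points of the constructions: `some t` stands for the grid line
`lineL t`, and `none` for the line `y = z = 0`. -/
def vec : Option ℂ → ℂ → Fin 4 → ℂ
  | some t, s => ![1, t, s, s * t]
  | none, s => ![1, 0, 0, -s]

/-- The first equation of the line with index `i`. -/
def eqF : Option ℂ → (Fin 4 → ℂ) →ₗ[ℂ] ℂ
  | some t => LinearMap.proj 1 - t • LinearMap.proj 0
  | none => LinearMap.proj 1

/-- The second equation of the line with index `i`. -/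
def eqG : Option ℂ → (Fin 4 → ℂ) →ₗ[ℂ] ℂ
  | some t => LinearMap.proj 3 - t • LinearMap.proj 2
  | none => LinearMap.proj 2

/-- The equation that cuts out the point `vec i s` on the line with index `i`. -/
def eqH : Option ℂ → ℂ → (Fin 4 → ℂ) →ₗ[ℂ] ℂ
  | some _, s => LinearMap.proj 2 - s • LinearMap.proj 0
  | none, s => LinearMap.proj 3 + s • LinearMap.proj 0

/-- The plane through `p` and the line with index `i`. -/
def planeOf (i : Option ℂ) (p : Fin 4 → ℂ) : (Fin 4 → ℂ) →ₗ[ℂ] ℂ :=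
  eqG i p • eqF i - eqF i p • eqG i

/-- A plane through `p` that meets the line with index `i` in `vec i s`. -/
def planeSep (i : Option ℂ) (s : ℂ) (p : Fin 4 → ℂ) : (Fin 4 → ℂ) →ₗ[ℂ] ℂ :=
  eqF i p • eqH i s - eqH i s p • eqF i

/-- The plane through `p` and the line `z = s x`, `w = s y` of the second ruling. -/
def planeM (s : ℂ) (p : Fin 4 → ℂ) : (Fin 4 → ℂ) →ₗ[ℂ] ℂ :=
  (p 3 - s * p 1) • (LinearMap.proj 2 - s • LinearMap.proj 0) -
    (p 2 - s * p 0) • (LinearMap.proj 3 - s • LinearMap.proj 1)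

lemma vec_ne_zero (i : Option ℂ) (s : ℂ) : vec i s ≠ 0 := by
  intro h
  have := congrFun h 0
  cases i <;> simp [vec] at this

/-- The point with homogeneous coordinates `vec i s`. -/
noncomputable def point (i : Option ℂ) (s : ℂ) : P3 := Projectivization.mk ℂ (vec i s) (vec_ne_zero i s)

/-- The points with parameters `s ∈ S` on the lines `lineL t`, `t ∈ T`, and on `y = z = 0`. -/
def unionSet (T S : Finset ℂ) : Set P3 :=
  {p | ∃ i ∈ Finset.insertNone T, ∃ s ∈ S, p = point i s}

lemma eqF_vec (i : Option ℂ) (s : ℂ) : eqF i (vec i s) = 0 := by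
  cases i <;> simp [eqF, vec]

lemma eqG_vec (i : Option ℂ) (s : ℂ) : eqG i (vec i s) = 0 := by
  cases i <;> simp [eqG, vec, mul_comm]

lemma planeOf_vec (i : Option ℂ) (s : ℂ) (p : Fin 4 → ℂ) : planeOf i p (vec i s) = 0 := by
  simp [planeOf, eqF_vec, eqG_vec]

lemma planeSep_vec_ne_zero {i : Option ℂ} {s s' : ℂ} (h : s ≠ s') {p : Fin 4 → ℂ}
    (hp : eqF i p ≠ 0) : planeSep i s p (vec i s') ≠ 0 := by
  have h' : s' - s ≠ 0 := sub_ne_zero.mpr h.symm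
  have h'' : -s' + s ≠ 0 := fun h0 => h' (by linear_combination -h0)
  simp only [planeSep, LinearMap.sub_apply, LinearMap.smul_apply, eqF_vec, smul_eq_mul,
    mul_zero, sub_zero]
  refine mul_ne_zero hp ?_
  cases i
  · simpa [eqH, vec] using h''
  · simpa [eqH, vec] using h'

lemma planeOf_self (i : Option ℂ) (p : Fin 4 → ℂ) : planeOf i p p = 0 := by
  simp [planeOf, mul_comm]

lemma planeSep_self (i : Option ℂ) (s : ℂ) (p : Fin 4 → ℂ) : planeSep i s p p = 0 := by
  simp [planeSep, mul_comm]

lemma planeM_self (s : ℂ) (p : Fin 4 → ℂ) : planeM s p p = 0 := by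
  simp [planeM]
  ring

lemma planeM_vec_some (s t : ℂ) (p : Fin 4 → ℂ) : planeM s p (vec (some t) s) = 0 := by
  simp [planeM, vec]

lemma planeM_vec_none_zero (p : Fin 4 → ℂ) : planeM 0 p (vec none 0) = 0 := by
  simp [planeM, vec]

/-- On the line `y = z = 0`, the planes of the two rulings are exchanged by `t ↦ s / t`. -/
lemma planeM_vec_none {s t : ℂ} (ht : t ≠ 0) (p : Fin 4 → ℂ) :
    planeM (s / t) p (vec none s) = s / t / t * planeOf (some t) p (vec none s) := by
  simp [planeM, planeOf, vec, eqF, eqG]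
  field_simp
  ring

/-- After subtracting a suitable multiple of p from x, all three forms `eqF`, `eqG`, `eqH` vanish,
and these cut out `vec i s`. After projection from p this says that the two planes become lines
meeting only in the image of `vec i s`. -/
lemma exists_of_planeOf_planeSep {i : Option ℂ} {s : ℂ} {p x : Fin 4 → ℂ} (hp : eqF i p ≠ 0)
    (h1 : planeOf i p x = 0) (h2 : planeSep i s p x = 0) :
    ∃ c d : ℂ, x = c • vec i s + d • p := by
  set r := eqF i x / eqF i p with hr
  have e1 : eqF i x = r * eqF i p := by rw [hr, div_mul_cancel₀ _ hp]
  simp only [planeOf, planeSep, LinearMap.sub_apply, LinearMap.smul_apply, smul_eq_mul] at h1 h2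
  have e2 : eqG i x = r * eqG i p := by
    apply mul_left_cancel₀ hp
    rw [e1] at h1
    linear_combination -h1
  have e3 : eqH i s x = r * eqH i s p := by
    apply mul_left_cancel₀ hp
    rw [e1] at h2
    linear_combination h2
  -- The first coordinate of `vec i s` is 1, which forces this coefficient.
  refine ⟨x 0 - r * p 0, r, ?_⟩
  clear_value r
  cases i with
  | none =>
    simp [eqF, eqG, eqH] at e1 e2 e3
    ext k
    fin_cases k
    · simp [vec]
    · simp [vec, e1]
    · simp [vec, e2]
    · simp [vec]
      linear_combination e3
  | some t =>
    simp [eqF, eqG, eqH] at e1 e2 e3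
    ext k
    fin_cases k
    · simp [vec]
    · simp [vec]
      linear_combination e1
    · simp [vec]
      linear_combination e3
    · simp [vec]
      linear_combination e2 + t * e3

/-! ### The form of degree b and the complete intersection -/

/-- The conditions on the centre of projection. -/
structure IsGeneral (n : ℕ) (T S : Finset ℂ) (p : Fin 4 → ℂ) : Prop where
  eqF_ne : ∀ i ∈ Finset.insertNone T, eqF i p ≠ 0
  planeOf_ne : ∀ i ∈ Finset.insertNone T, ∀ j ∈ Finset.insertNone T, i ≠ j → ∀ s ∈ S,
    planeOf i p (vec j s) ≠ 0
  -- The centre avoids the tangent plane of xw = yz at `vec (some t) s`, which is spanned by `lineL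
  -- t` and `lineM s`.
  tangent_ne : ∀ t ∈ T, ∀ s ∈ S, p 3 - s * p 1 - t * p 2 + s * t * p 0 ≠ 0
  -- This and the next condition keep the form of degree b nonzero at [0:0:0:1], a point of y = z =
  -- 0.
  pow_ne : p 1 ^ n - p 2 ^ n ≠ 0
  coord_ne : p 2 ≠ 0

/-- The plane spanned by `lineL t` and `vec none s` also contains `lineM (s / t)`, so the two values
are proportional, with factor (s / t) / t. Since t ↦ s / t permutes the roots of unity, these
factors have product 1. -/
lemma prod_planeM_vec_none {n : ℕ} (hn : 0 < n) {s : ℂ} (hs : s ^ n = 1) (p : Fin 4 → ℂ) :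
    ∏ t ∈ Polynomial.nthRootsFinset n 1, planeM t p (vec none s) =
      ∏ t ∈ Polynomial.nthRootsFinset n 1, planeOf (some t) p (vec none s) := by
  have hs0 : s ≠ 0 := by
    rintro rfl
    simp [hn.ne'] at hs
  have h0 : ∀ t ∈ Polynomial.nthRootsFinset n (1 : ℂ), t ≠ 0 := by
    intro t ht h
    rw [Polynomial.mem_nthRootsFinset hn, h] at ht
    simp [hn.ne'] at ht
  have hmem : ∀ t ∈ Polynomial.nthRootsFinset n (1 : ℂ),
      s / t ∈ Polynomial.nthRootsFinset n (1 : ℂ) := by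
    intro t ht
    rw [Polynomial.mem_nthRootsFinset hn] at ht ⊢
    rw [div_pow, hs, ht, div_one]
  have hinv : ∀ t ∈ Polynomial.nthRootsFinset n (1 : ℂ), s / (s / t) = t := fun t _ =>
    div_div_cancel₀ hs0
  have hperm : ∀ f : ℂ → ℂ, ∏ t ∈ Polynomial.nthRootsFinset n (1 : ℂ), f (s / t) =
      ∏ t ∈ Polynomial.nthRootsFinset n (1 : ℂ), f t := fun f =>
    Finset.prod_bij' (fun t _ => s / t) (fun t _ => s / t) hmem hmem hinv hinv (fun _ _ => rfl)
  rw [← hperm, Finset.prod_congr rfl fun t ht => planeM_vec_none (h0 t ht) p,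
    Finset.prod_mul_distrib, Finset.prod_div_distrib, hperm (fun t => t),
    div_self (Finset.prod_ne_zero_iff.mpr h0), one_mul]

/-- The product of the planes through `p` and a line of the first ruling minus the product for the
second ruling, times further planes for the second ruling, evaluated at `x`. -/
noncomputable def coneForm (n : ℕ) (E : Finset ℂ) (p x : Fin 4 → ℂ) : ℂ :=
  (∏ t ∈ Polynomial.nthRootsFinset n 1, planeOf (some t) p x -
    ∏ s ∈ Polynomial.nthRootsFinset n 1, planeM s p x) * ∏ s ∈ E, planeM s p x

lemma coneForm_vec {n : ℕ} (hn : 0 < n) {E T : Finset ℂ} (hE : ∀ s ∈ E, s = 0)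
    (hT : T ⊆ Polynomial.nthRootsFinset n 1) {i : Option ℂ} (hi : i ∈ Finset.insertNone T) {s : ℂ}
    (hs : s ∈ Polynomial.nthRootsFinset n 1 ∪ E) (p : Fin 4 → ℂ) :
    coneForm n E p (vec i s) = 0 := by
  rw [coneForm]
  rcases Finset.mem_union.mp hs with hs | hs
  · apply mul_eq_zero_of_left
    cases i with
    | none =>
      rw [prod_planeM_vec_none hn ((Polynomial.mem_nthRootsFinset hn _).mp hs), sub_self]
    | some t =>
      rw [Finset.prod_eq_zero (hT (Finset.some_mem_insertNone.mp hi)) (planeOf_vec _ _ _),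
        Finset.prod_eq_zero hs (planeM_vec_some _ _ _), sub_self]
  · apply mul_eq_zero_of_right
    apply Finset.prod_eq_zero hs
    obtain rfl := hE s hs
    cases i
    · exact planeM_vec_none_zero p
    · exact planeM_vec_some _ _ p

/-- The witness is the point of the line in the plane x = 0. On y = z = 0 the difference of products
becomes ±(p₁ⁿ - p₂ⁿ). On `lineL t` the first product vanishes, while every factor of the other
products is nonzero because p avoids the tangent planes. -/
lemma exists_coneForm_ne_zero {n : ℕ} (hn : 0 < n) {E T : Finset ℂ} (hE : ∀ s ∈ E, s = 0)
    (hT : T ⊆ Polynomial.nthRootsFinset n 1) {p : Fin 4 → ℂ}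
    (hp : IsGeneral n T (Polynomial.nthRootsFinset n 1 ∪ E) p)
    {i : Option ℂ} (hi : i ∈ Finset.insertNone T) :
    ∃ x, planeOf i p x = 0 ∧ coneForm n E p x ≠ 0 := by
  cases i with
  | none =>
    refine ⟨![0, 0, 0, 1], by simp [planeOf, eqF, eqG], ?_⟩
    have hζ := Complex.isPrimitiveRoot_exp n hn.ne'
    have h1 : ∀ t, planeOf (some t) p ![0, 0, 0, 1] = -(p 1 - t * p 0) := by
      intro t; simp [planeOf, eqF, eqG]
    have h2 : ∀ t, planeM t p ![0, 0, 0, 1] = -(p 2 - t * p 0) := by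
      intro t; simp [planeM]
    rw [coneForm]
    refine mul_ne_zero ?_ (Finset.prod_ne_zero_iff.mpr ?_)
    · simp only [h1, h2, Finset.prod_neg]
      rw [← hζ.pow_sub_pow_eq_prod_sub_mul _ _ hn, ← hζ.pow_sub_pow_eq_prod_sub_mul _ _ hn,
        ← mul_sub]
      refine mul_ne_zero (pow_ne_zero _ (by simp)) ?_
      have := hp.pow_ne
      intro h
      apply this
      linear_combination h
    · intro s hs
      rw [h2, hE s hs]
      simpa using hp.coord_ne
  | some t =>
    have htT : t ∈ T := Finset.some_mem_insertNone.mp hi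
    refine ⟨![0, 0, 1, t], by simp [planeOf, eqF, eqG], ?_⟩
    have h2 : ∀ s ∈ Polynomial.nthRootsFinset n 1 ∪ E, planeM s p ![0, 0, 1, t] ≠ 0 := by
      intro s hs h
      apply hp.tangent_ne t htT s hs
      simp [planeM] at h
      linear_combination h
    rw [coneForm, Finset.prod_eq_zero (hT htT) (by simp [planeOf, eqF, eqG]), zero_sub]
    refine mul_ne_zero (neg_ne_zero.mpr (Finset.prod_ne_zero_iff.mpr ?_))
      (Finset.prod_ne_zero_iff.mpr ?_)
    · exact fun s hs => h2 s (Finset.mem_union_left _ hs)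
    · exact fun s hs => h2 s (Finset.mem_union_right _ hs)

lemma isPlaneCI_of_isGeneral {n : ℕ} (hn : 0 < n) {E T : Finset ℂ} (hE : ∀ s ∈ E, s = 0)
    (hT : T ⊆ Polynomial.nthRootsFinset n 1) {P : P3}
    (hp : IsGeneral n T (Polynomial.nthRootsFinset n 1 ∪ E) P.rep)
    {φ : (Fin 4 → ℂ) →ₗ[ℂ] (Fin 3 → ℂ)} (hφ : IsProjectionFrom P φ) :
    IsPlaneCI (T.card + 1) (Polynomial.nthRootsFinset n (1 : ℂ) ∪ E).card
      (projImage φ (unionSet T (Polynomial.nthRootsFinset n 1 ∪ E))) := by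
  set p := P.rep with hpdef
  have hker : LinearMap.ker φ = ℂ ∙ p := by rw [hφ, Projectivization.submodule_eq]
  have hp0 : p ≠ 0 := P.rep_nonzero
  have hsurj : LinearMap.range φ = ⊤ := by
    apply Submodule.eq_top_of_finrank_eq
    have := LinearMap.finrank_range_add_finrank_ker φ
    rw [hker, finrank_span_singleton hp0] at this
    simp at this ⊢
    omega
  obtain ⟨ψ, hψ⟩ := φ.exists_rightInverse_of_surjective hsurj
  have hψφ : ∀ y, φ (ψ y) = y := fun y => congrArg (fun f => f y) hψ
  -- A linear form vanishing at p descends to the plane as its composite with the section ψ. Hence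
  -- an arbitrary φ with kernel p can be treated without choosing coordinates.
  have hdesc : ∀ (f : (Fin 4 → ℂ) →ₗ[ℂ] ℂ), f p = 0 → ∀ x, f (ψ (φ x)) = f x := by
    intro f hf x
    have hx : ψ (φ x) - x ∈ LinearMap.ker φ := by simp [hψφ]
    rw [hker] at hx
    obtain ⟨c, hc⟩ := Submodule.mem_span_singleton.mp hx
    have := congrArg f hc
    simp only [map_smul, hf, smul_zero, map_sub] at this
    exact (sub_eq_zero.mp this.symm)
  set μ := Polynomial.nthRootsFinset n (1 : ℂ) with hμ
  have h0μ : ∀ s ∈ μ, s ≠ 0 := by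
    intro t ht h
    rw [hμ, Polynomial.mem_nthRootsFinset hn, h] at ht
    simp [hn.ne'] at ht
  have hdisj : Disjoint μ E := by
    rw [Finset.disjoint_left]
    exact fun s hs hsE => h0μ s hs (hE s hsE)
  set S := μ ∪ E with hSdef
  have hSne : S.Nonempty :=
    ⟨1, Finset.mem_union_left _ ((Polynomial.mem_nthRootsFinset hn _).mpr (one_pow n))⟩
  set G : MvPolynomial (Fin 3) ℂ :=
    (∏ t ∈ μ, linForm (planeOf (some t) p ∘ₗ ψ) - ∏ s ∈ μ, linForm (planeM s p ∘ₗ ψ)) *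
      ∏ s ∈ E, linForm (planeM s p ∘ₗ ψ) with hGdef
  have hG : G.IsHomogeneous S.card := by
    rw [hSdef, Finset.card_union_of_disjoint hdisj]
    exact ((isHomogeneous_prod_linForm _ _).sub (isHomogeneous_prod_linForm _ _)).mul
      (isHomogeneous_prod_linForm _ _)
  have hGφ : ∀ x, MvPolynomial.eval (φ x) G = coneForm n E p x := by
    intro x
    simp [hGdef, coneForm, hdesc _ (planeOf_self _ p),
      hdesc _ (planeM_self _ p), hμ]
  have hvec : ∀ i ∈ Finset.insertNone T, ∀ s ∈ S, φ (vec i s) ≠ 0 := by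
    intro i hi s hs h
    have : vec i s ∈ LinearMap.ker φ := h
    rw [hker] at this
    obtain ⟨c, hc⟩ := Submodule.mem_span_singleton.mp this
    have h1 := congrArg (eqF i) hc
    rw [eqF_vec, map_smul, smul_eq_mul, mul_eq_zero] at h1
    rcases h1 with h1 | h1
    · rw [h1, zero_smul] at hc
      exact vec_ne_zero i s hc.symm
    · exact hp.eqF_ne i hi h1
  have hcone : ∀ x : Fin 3 → ℂ, (∃ q ∈ projImage φ (unionSet T S), x ∈ q.submodule) ↔
      ∃ i ∈ Finset.insertNone T, ∃ s ∈ S, ∃ c : ℂ, x = c • φ (vec i s) := by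
    intro x
    constructor
    · rintro ⟨q, ⟨_, ⟨i, hi, s, hs, rfl⟩, hq⟩, hx⟩
      rw [hq, point, Projectivization.submodule_mk, Submodule.map_span, Set.image_singleton] at hx
      obtain ⟨c, hc⟩ := Submodule.mem_span_singleton.mp hx
      exact ⟨i, hi, s, hs, c, hc.symm⟩
    · rintro ⟨i, hi, s, hs, c, rfl⟩
      refine ⟨Projectivization.mk ℂ (φ (vec i s)) (hvec i hi s hs),
        ⟨point i s, ⟨i, hi, s, hs, rfl⟩, ?_⟩, ?_⟩
      · rw [point, Projectivization.submodule_mk, Projectivization.submodule_mk,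
          Submodule.map_span, Set.image_singleton]
      · rw [Projectivization.submodule_mk]
        exact Submodule.smul_mem _ _ (Submodule.mem_span_singleton_self _)
  have hGv : ∀ i ∈ Finset.insertNone T, ∀ s ∈ S, MvPolynomial.eval (φ (vec i s)) G = 0 := by
    intro i hi s hs
    rw [hGφ, coneForm_vec hn hE hT hi hs]
  refine ⟨∏ i ∈ Finset.insertNone T, linForm (planeOf i p ∘ₗ ψ), G, ?_, hG, ?_⟩
  · rw [← Finset.card_insertNone]
    exact isHomogeneous_prod_linForm _ _
  apply le_antisymm
  · intro H hH
    rw [idealOf, MvPolynomial.mem_vanishingIdeal_iff] at hH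
    refine mem_span_prod_linForm (m := fun i s => planeSep i s p ∘ₗ ψ)
      (v := fun i s => φ (vec i s)) hSne _ hvec ?_ ?_ ?_ ?_ hG hGv ?_ H ?_
    · intro i hi s hs x h1 h2
      obtain ⟨c, d, hcd⟩ := exists_of_planeOf_planeSep (hp.eqF_ne i hi) h1 h2
      refine ⟨c, ?_⟩
      have hpk : φ p = 0 := by
        rw [← LinearMap.mem_ker, hker]
        exact Submodule.mem_span_singleton_self _
      rw [← hψφ x, hcd]
      simp [hpk]
    · intro i hi s hs
      rw [LinearMap.comp_apply, hdesc _ (planeOf_self _ p), planeOf_vec]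
    · intro i hi s hs s' hs' hss
      rw [LinearMap.comp_apply, hdesc _ (planeSep_self _ _ p)]
      exact planeSep_vec_ne_zero hss (hp.eqF_ne i hi)
    · intro i hi j hj hij s hs
      rw [LinearMap.comp_apply, hdesc _ (planeOf_self _ p)]
      exact hp.planeOf_ne i hi j hj hij s hs
    · intro i hi
      obtain ⟨x, hx, hx'⟩ := exists_coneForm_ne_zero hn hE hT hp hi
      refine ⟨φ x, ?_, ?_⟩
      · rw [LinearMap.comp_apply, hdesc _ (planeOf_self _ p), hx]
      · rwa [hGφ]
    · intro i hi s hs c _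
      exact hH _ ((hcone _).mpr ⟨i, hi, s, hs, c, rfl⟩)
  · rw [Ideal.span_le, Set.pair_subset_iff]
    constructor
    · rw [SetLike.mem_coe, idealOf, MvPolynomial.mem_vanishingIdeal_iff]
      intro x hx
      obtain ⟨i, hi, s, hs, c, rfl⟩ := (hcone x).mp hx
      change MvPolynomial.eval _ _ = 0
      rw [MvPolynomial.eval_prod]
      apply Finset.prod_eq_zero hi
      rw [eval_linForm, map_smul, LinearMap.comp_apply, hdesc _ (planeOf_self _ p), planeOf_vec,
        smul_zero]
    · rw [SetLike.mem_coe, idealOf, MvPolynomial.mem_vanishingIdeal_iff]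
      intro x hx
      obtain ⟨i, hi, s, hs, c, rfl⟩ := (hcone x).mp hx
      change MvPolynomial.eval _ _ = 0
      rw [eval_smul_of_isHomogeneous hG, hGv i hi s hs, mul_zero]

/-! ### General points, and the geproci property -/

lemma ForGeneralPoint.and {Q Q' : P3 → Prop} (h : ForGeneralPoint Q) (h' : ForGeneralPoint Q') :
    ForGeneralPoint fun P => Q P ∧ Q' P := by
  obtain ⟨d, F, hF, hFd, hFQ⟩ := h
  obtain ⟨d', F', hF', hFd', hFQ'⟩ := h'
  refine ⟨d + d', F * F', mul_ne_zero hF hF', hFd.mul hFd', fun P hP => ?_⟩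
  rw [map_mul] at hP
  exact ⟨hFQ P (left_ne_zero_of_mul hP), hFQ' P (right_ne_zero_of_mul hP)⟩

lemma ForGeneralPoint.mono {Q Q' : P3 → Prop} (h : ForGeneralPoint Q) (hQ : ∀ P, Q P → Q' P) :
    ForGeneralPoint Q' := by
  obtain ⟨d, F, hF, hFd, hFQ⟩ := h
  exact ⟨d, F, hF, hFd, fun P hP => hQ P (hFQ P hP)⟩

lemma ForGeneralPoint.of_forall {Q : P3 → Prop} (h : ∀ P, Q P) : ForGeneralPoint Q :=
  ⟨0, 1, one_ne_zero, MvPolynomial.isHomogeneous_one _ _, fun P _ => h P⟩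

lemma ForGeneralPoint.forall_mem {ι : Type*} (s : Finset ι) {Q : ι → P3 → Prop}
    (h : ∀ i ∈ s, ForGeneralPoint (Q i)) : ForGeneralPoint fun P => ∀ i ∈ s, Q i P := by
  classical
  induction s using Finset.induction_on with
  | empty => exact .of_forall (by simp)
  | insert i s hi ih =>
    refine ((h i (Finset.mem_insert_self i s)).and
      (ih fun j hj => h j (Finset.mem_insert_of_mem hj))).mono fun P hP => ?_
    simpa using hP

lemma ForGeneralPoint.linear {f : (Fin 4 → ℂ) →ₗ[ℂ] ℂ} (hf : f ≠ 0) :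
    ForGeneralPoint fun P => f P.rep ≠ 0 :=
  ⟨1, linForm f, linForm_ne_zero hf, isHomogeneous_linForm f, fun P hP => by simpa using hP⟩

/-- The value is also linear in p, and it is identically zero only if `vec j s` lies on the line
with index i. The index `some 0` is excluded because `lineL 0` meets y = z = 0. -/
lemma forGeneralPoint_planeOf_ne {i j : Option ℂ} (hij : i ≠ j) (hi : i ≠ some 0)
    (hj : j ≠ some 0) (s : ℂ) : ForGeneralPoint fun P => planeOf i P.rep (vec j s) ≠ 0 := by
  have h : ∀ p, planeOf i p (vec j s) = (eqF i (vec j s) • eqG i - eqG i (vec j s) • eqF i) p := by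
    intro p
    simp [planeOf, mul_comm]
  simp only [h]
  apply ForGeneralPoint.linear
  intro h0
  have e2 := congrArg (fun f => f (Pi.single 2 1)) h0
  have e3 := congrArg (fun f => f (Pi.single 3 1)) h0
  cases i with
  | none =>
    cases j with
    | none => exact hij rfl
    | some t =>
      simp [eqF, eqG, vec] at e2
      exact hj (by rw [e2])
  | some t =>
    cases j with
    | none =>
      simp [eqF, eqG, vec] at e3
      exact hi (by rw [e3])
    | some t' =>
      simp [eqF, eqG, vec] at e3
      exact hij (by rw [sub_eq_zero.mp e3])

lemma forGeneralPoint_isGeneral {n : ℕ} (hn : 0 < n) {T S : Finset ℂ} (hT : ∀ t ∈ T, t ≠ 0) :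
    ForGeneralPoint fun P => IsGeneral n T S P.rep := by
  have hne : ∀ i ∈ Finset.insertNone T, i ≠ some 0 := by
    rintro i hi rfl
    exact hT 0 (Finset.some_mem_insertNone.mp hi) rfl
  have h1 : ForGeneralPoint fun P => ∀ i ∈ Finset.insertNone T, eqF i P.rep ≠ 0 := by
    refine .forall_mem _ fun i _ => .linear fun h => ?_
    have := congrArg (fun f => f (Pi.single 1 1)) h
    cases i <;> simp [eqF] at this
  have h2 : ForGeneralPoint fun P => ∀ i ∈ Finset.insertNone T, ∀ j ∈ Finset.insertNone T,
      i ≠ j → ∀ s ∈ S, planeOf i P.rep (vec j s) ≠ 0 := by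
    refine .forall_mem _ fun i hi => .forall_mem _ fun j hj => ?_
    by_cases hij : i = j
    · exact .of_forall fun P h => absurd hij h
    · exact (ForGeneralPoint.forall_mem S fun s _ =>
        forGeneralPoint_planeOf_ne hij (hne i hi) (hne j hj) s).mono fun P h _ => h
  have h3 : ForGeneralPoint fun P => ∀ t ∈ T, ∀ s ∈ S,
      P.rep 3 - s * P.rep 1 - t * P.rep 2 + s * t * P.rep 0 ≠ 0 := by
    refine .forall_mem _ fun t _ => .forall_mem _ fun s _ => ?_
    refine ForGeneralPoint.linear (f := LinearMap.proj 3 - s • LinearMap.proj 1 -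
      t • LinearMap.proj 2 + (s * t) • LinearMap.proj 0) fun h => ?_
    have := congrArg (fun f => f (Pi.single 3 1)) h
    simp at this
  have h4 : ForGeneralPoint fun P => P.rep 1 ^ n - P.rep 2 ^ n ≠ 0 := by
    refine ⟨n, MvPolynomial.X 1 ^ n - MvPolynomial.X 2 ^ n, fun h => ?_,
      (MvPolynomial.isHomogeneous_X_pow _ _).sub (MvPolynomial.isHomogeneous_X_pow _ _),
      fun P hP => by simpa using hP⟩
    have := congrArg (MvPolynomial.eval (Pi.single 1 1)) h
    simp [hn.ne'] at this
  have h5 : ForGeneralPoint fun P => P.rep 2 ≠ 0 := by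
    refine ForGeneralPoint.linear (f := LinearMap.proj 2) fun h => ?_
    have := congrArg (fun f => f (Pi.single 2 1)) h
    simp at this
  exact (h1.and (h2.and (h3.and (h4.and h5)))).mono fun P h =>
    ⟨h.1, h.2.1, h.2.2.1, h.2.2.2.1, h.2.2.2.2⟩

lemma unionSet_finite (T S : Finset ℂ) : (unionSet T S).Finite := by
  refine (Set.Finite.image2 point (Finset.insertNone T).finite_toSet S.finite_toSet).subset ?_
  rintro _ ⟨i, hi, s, hs, rfl⟩
  exact ⟨i, hi, s, hs, rfl⟩

theorem isGeproci_unionSet {n : ℕ} (hn : 0 < n) {E T : Finset ℂ} (hE : ∀ s ∈ E, s = 0)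
    (hT : T ⊆ Polynomial.nthRootsFinset n 1)
    (hc : T.card + 1 ≤ (Polynomial.nthRootsFinset n (1 : ℂ) ∪ E).card) :
    IsGeproci (T.card + 1) (Polynomial.nthRootsFinset n (1 : ℂ) ∪ E).card
      (unionSet T (Polynomial.nthRootsFinset n 1 ∪ E)) := by
  have hT0 : ∀ t ∈ T, t ≠ 0 := by
    intro t ht h
    have := hT ht
    rw [Polynomial.mem_nthRootsFinset hn, h] at this
    simp [hn.ne'] at this
  refine ⟨unionSet_finite _ _, hc, (forGeneralPoint_isGeneral hn hT0).mono fun P hP =>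
    ⟨?_, fun φ hφ => isPlaneCI_of_isGeneral hn hE hT hP hφ⟩⟩
  rintro ⟨i, hi, s, hs, h⟩
  apply hP.eqF_ne i hi
  have h1 : P.rep ∈ P.submodule := by
    rw [Projectivization.submodule_eq]
    exact Submodule.mem_span_singleton_self _
  rw [h, point, Projectivization.submodule_mk] at h1
  obtain ⟨c, hc⟩ := Submodule.mem_span_singleton.mp h1
  rw [h, point, ← hc, map_smul, eqF_vec, smul_zero]

/-! ### Lines with many points -/

lemma mk_mem_pointsOf {v : Fin 4 → ℂ} (hv : v ≠ 0) (W : Submodule ℂ (Fin 4 → ℂ)) :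
    Projectivization.mk ℂ v hv ∈ pointsOf W ↔ v ∈ W := by
  change (Projectivization.mk ℂ v hv).submodule ≤ W ↔ _
  rw [Projectivization.submodule_mk, Submodule.span_singleton_le_iff_mem]

lemma mem_pointsOf_iff_rep {p : P3} {W : Submodule ℂ (Fin 4 → ℂ)} :
    p ∈ pointsOf W ↔ p.rep ∈ W := by
  conv_lhs => rw [← p.mk_rep]
  exact mk_mem_pointsOf _ W

lemma linearIndependent_pair_of_mk_ne {u v : Fin 4 → ℂ} {hu : u ≠ 0} {hv : v ≠ 0}
    (h : Projectivization.mk ℂ u hu ≠ Projectivization.mk ℂ v hv) :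
    LinearIndependent ℂ ![u, v] := by
  rw [LinearIndependent.pair_iff' hu]
  intro a ha
  exact h.symm ((Projectivization.mk_eq_mk_iff' ℂ v u hv hu).mpr ⟨a, ha⟩)

lemma isLine_span_pair {u v : Fin 4 → ℂ} (h : LinearIndependent ℂ ![u, v]) :
    IsLine (Submodule.span ℂ {u, v}) := by
  have := finrank_span_eq_card h
  rwa [Matrix.range_cons, Matrix.range_cons, Matrix.range_empty, Set.union_empty,
    Set.singleton_union] at this

lemma IsLine.eq_span {W : Submodule ℂ (Fin 4 → ℂ)} (hW : IsLine W) {u v : Fin 4 → ℂ}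
    (h : LinearIndependent ℂ ![u, v]) (hu : u ∈ W) (hv : v ∈ W) :
    Submodule.span ℂ {u, v} = W := by
  apply Submodule.eq_of_le_of_finrank_eq
  · rw [Submodule.span_le, Set.pair_subset_iff]
    exact ⟨hu, hv⟩
  · rw [hW, isLine_span_pair h]

lemma linearIndependent_rep {p q : P3} (h : p ≠ q) : LinearIndependent ℂ ![p.rep, q.rep] := by
  apply linearIndependent_pair_of_mk_ne (hu := p.rep_nonzero) (hv := q.rep_nonzero)
  rwa [p.mk_rep, q.mk_rep]

/-- Two distinct points lie on at most one line. -/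
lemma IsLine.eq_of_mem {W W' : Submodule ℂ (Fin 4 → ℂ)} (hW : IsLine W) (hW' : IsLine W')
    {p q : P3} (h : p ≠ q) (hp : p ∈ pointsOf W) (hq : q ∈ pointsOf W) (hp' : p ∈ pointsOf W')
    (hq' : q ∈ pointsOf W') : W = W' := by
  rw [mem_pointsOf_iff_rep] at hp hq hp' hq'
  rw [← hW.eq_span (linearIndependent_rep h) hp hq, hW'.eq_span (linearIndependent_rep h) hp' hq']

/-- The line `y = z = 0` for `none`, and `lineL t` for `some t`. -/
def gridLine : Option ℂ → Submodule ℂ (Fin 4 → ℂ)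
  | some t => lineL t
  | none => Submodule.span ℂ {![1, 0, 0, 0], ![0, 0, 0, 1]}

/-- The line `z = s x`, `w = s y` of the second ruling. -/
def lineM (s : ℂ) : Submodule ℂ (Fin 4 → ℂ) := Submodule.span ℂ {![1, 0, s, 0], ![0, 1, 0, s]}

lemma mem_lineL {t : ℂ} {x : Fin 4 → ℂ} : x ∈ lineL t ↔ x 1 = t * x 0 ∧ x 3 = t * x 2 := by
  rw [lineL, Submodule.mem_span_pair]
  constructor
  · rintro ⟨c, d, rfl⟩
    constructor <;> simp [mul_comm]
  · rintro ⟨h1, h2⟩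
    refine ⟨x 0, x 2, ?_⟩
    ext k
    fin_cases k <;> simp [h1, h2, mul_comm]

lemma mem_gridLine_none {x : Fin 4 → ℂ} : x ∈ gridLine none ↔ x 1 = 0 ∧ x 2 = 0 := by
  rw [gridLine, Submodule.mem_span_pair]
  constructor
  · rintro ⟨c, d, rfl⟩
    constructor <;> simp
  · rintro ⟨h1, h2⟩
    refine ⟨x 0, x 3, ?_⟩
    ext k
    fin_cases k <;> simp [h1, h2]

lemma mem_lineM {s : ℂ} {x : Fin 4 → ℂ} : x ∈ lineM s ↔ x 2 = s * x 0 ∧ x 3 = s * x 1 := by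
  rw [lineM, Submodule.mem_span_pair]
  constructor
  · rintro ⟨c, d, rfl⟩
    constructor <;> simp [mul_comm]
  · rintro ⟨h1, h2⟩
    refine ⟨x 0, x 1, ?_⟩
    ext k
    fin_cases k <;> simp [h1, h2, mul_comm]

lemma isLine_gridLine (i : Option ℂ) : IsLine (gridLine i) := by
  cases i with
  | none =>
    apply isLine_span_pair
    rw [LinearIndependent.pair_iff]
    intro c d h
    exact ⟨by simpa using congrFun h 0, by simpa using congrFun h 3⟩
  | some t =>
    apply isLine_span_pair
    rw [LinearIndependent.pair_iff]
    intro c d h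
    exact ⟨by simpa using congrFun h 0, by simpa using congrFun h 2⟩

lemma isLine_lineM (s : ℂ) : IsLine (lineM s) := by
  apply isLine_span_pair
  rw [LinearIndependent.pair_iff]
  intro c d h
  exact ⟨by simpa using congrFun h 0, by simpa using congrFun h 1⟩

lemma point_mem_pointsOf {i : Option ℂ} {s : ℂ} {W : Submodule ℂ (Fin 4 → ℂ)} :
    point i s ∈ pointsOf W ↔ vec i s ∈ W := mk_mem_pointsOf _ W

lemma point_eq_iff {i j : Option ℂ} (hi : i ≠ some 0) (hj : j ≠ some 0) {s s' : ℂ} :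
    point i s = point j s' ↔ i = j ∧ s = s' := by
  refine ⟨fun h => ?_, fun h => by rw [h.1, h.2]⟩
  rw [point, point, Projectivization.mk_eq_mk_iff'] at h
  obtain ⟨a, ha⟩ := h
  have h0 := congrFun ha 0
  have ha1 : a = 1 := by
    cases i <;> cases j <;> simpa [vec] using h0
  rw [ha1, one_smul] at ha
  have h1 := congrFun ha 1
  have h2 := congrFun ha 2
  have h3 := congrFun ha 3
  cases i with
  | none =>
    cases j with
    | none => exact ⟨rfl, by simpa [vec] using h3.symm⟩
    | some t => exact absurd (by simpa [vec] using h1) hj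
  | some t =>
    cases j with
    | none => exact absurd (by simpa [vec] using h1.symm) hi
    | some t' => exact ⟨by simpa [vec] using h1.symm, by simpa [vec] using h2.symm⟩

lemma vec_mem_gridLine (i : Option ℂ) (s : ℂ) : vec i s ∈ gridLine i := by
  cases i with
  | none => rw [mem_gridLine_none]; simp [vec]
  | some t => exact mem_lineL.mpr (by simp [vec, mul_comm])

lemma vec_mem_gridLine_iff {i j : Option ℂ} (hi : i ≠ some 0) (hj : j ≠ some 0) {s : ℂ} :
    vec j s ∈ gridLine i ↔ i = j := by
  refine ⟨fun h => ?_, fun h => h ▸ vec_mem_gridLine i s⟩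
  cases i with
  | none =>
    cases j with
    | none => rfl
    | some t => exact absurd (by simpa [vec] using (mem_gridLine_none.mp h).1) hj
  | some t =>
    have h1 := (mem_lineL.mp h).1
    cases j with
    | none => exact absurd (by simpa [vec] using h1.symm) hi
    | some t' => simpa [vec] using h1.symm

lemma vec_mem_lineM_iff {i : Option ℂ} {s s' : ℂ} :
    vec i s' ∈ lineM s ↔ s' = s ∧ (i = none → s = 0) := by
  rw [mem_lineM]
  cases i with
  | none =>
    constructor
    · rintro ⟨h1, h2⟩
      simp [vec] at h1 h2
      simp [h1, h2]
    · rintro ⟨rfl, h⟩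
      simp [vec, h rfl]
  | some t => simp +contextual [vec]

lemma ne_some_zero {T : Finset ℂ} (hT : ∀ t ∈ T, t ≠ 0) {i : Option ℂ}
    (hi : i ∈ Finset.insertNone T) : i ≠ some 0 := by
  rintro rfl
  exact hT 0 (Finset.some_mem_insertNone.mp hi) rfl

lemma gridLine_injOn {T : Finset ℂ} (hT : ∀ t ∈ T, t ≠ 0) :
    Set.InjOn gridLine (Finset.insertNone T) := by
  intro i hi j hj h
  have := vec_mem_gridLine j 0
  rw [← h] at this
  exact (vec_mem_gridLine_iff (ne_some_zero hT hi) (ne_some_zero hT hj)).mp this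

lemma gridLine_ne_lineM (i : Option ℂ) (s : ℂ) : gridLine i ≠ lineM s := by
  intro h
  have h1 := vec_mem_gridLine i (s + 1)
  rw [h, vec_mem_lineM_iff] at h1
  simpa using h1.1

lemma encard_inter_gridLine {T S : Finset ℂ} (hT : ∀ t ∈ T, t ≠ 0) {i : Option ℂ}
    (hi : i ∈ Finset.insertNone T) :
    (unionSet T S ∩ pointsOf (gridLine i)).encard = S.card := by
  have h : unionSet T S ∩ pointsOf (gridLine i) = point i '' S := by
    ext p
    constructor
    · rintro ⟨⟨j, hj, s, hs, rfl⟩, h⟩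
      rw [point_mem_pointsOf, vec_mem_gridLine_iff (ne_some_zero hT hi) (ne_some_zero hT hj)] at h
      exact ⟨s, hs, by rw [h]⟩
    · rintro ⟨s, hs, rfl⟩
      exact ⟨⟨i, hi, s, hs, rfl⟩, point_mem_pointsOf.mpr (vec_mem_gridLine i s)⟩
  rw [h, Set.InjOn.encard_image, Set.encard_coe_eq_coe_finsetCard]
  intro s _ s' _ h
  exact ((point_eq_iff (ne_some_zero hT hi) (ne_some_zero hT hi)).mp h).2

lemma encard_inter_lineM {T S : Finset ℂ} (hT : ∀ t ∈ T, t ≠ 0) {s : ℂ} (hs : s ∈ S)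
    (hs0 : s ≠ 0) : (unionSet T S ∩ pointsOf (lineM s)).encard = T.card := by
  have h : unionSet T S ∩ pointsOf (lineM s) = (fun t => point (some t) s) '' T := by
    ext p
    constructor
    · rintro ⟨⟨j, hj, s', hs', rfl⟩, h⟩
      rw [point_mem_pointsOf, vec_mem_lineM_iff] at h
      obtain ⟨rfl, h⟩ := h
      cases j with
      | none => exact absurd (h rfl) hs0
      | some t => exact ⟨t, Finset.some_mem_insertNone.mp hj, rfl⟩
    · rintro ⟨t, ht, rfl⟩
      exact ⟨⟨some t, Finset.some_mem_insertNone.mpr ht, s, hs, rfl⟩,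
        point_mem_pointsOf.mpr (vec_mem_lineM_iff.mpr ⟨rfl, by simp⟩)⟩
  rw [h, Set.InjOn.encard_image, Set.encard_coe_eq_coe_finsetCard]
  intro t ht t' ht' h
  have := (point_eq_iff (by simpa using hT t ht) (by simpa using hT t' ht')).mp h
  simpa using this.1

lemma encard_inter_lineM_zero {T S : Finset ℂ} (hT : ∀ t ∈ T, t ≠ 0) (hS : 0 ∈ S) :
    (unionSet T S ∩ pointsOf (lineM 0)).encard = (T.card + 1 : ℕ) := by
  have h : unionSet T S ∩ pointsOf (lineM 0) = (fun i => point i 0) '' Finset.insertNone T := by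
    ext p
    constructor
    · rintro ⟨⟨j, hj, s', hs', rfl⟩, h⟩
      rw [point_mem_pointsOf, vec_mem_lineM_iff] at h
      exact ⟨j, hj, by rw [h.1]⟩
    · rintro ⟨i, hi, rfl⟩
      exact ⟨⟨i, hi, 0, hS, rfl⟩, point_mem_pointsOf.mpr (vec_mem_lineM_iff.mpr ⟨rfl, by simp⟩)⟩
  rw [h, Set.InjOn.encard_image, Set.encard_coe_eq_coe_finsetCard, Finset.card_insertNone]
  intro i hi j hj h
  exact ((point_eq_iff (ne_some_zero hT hi) (ne_some_zero hT hj)).mp h).1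

lemma encard_unionSet {T S : Finset ℂ} (hT : ∀ t ∈ T, t ≠ 0) :
    (unionSet T S).encard = ((T.card + 1) * S.card : ℕ) := by
  have h : unionSet T S =
      (fun x : Option ℂ × ℂ => point x.1 x.2) '' (Finset.insertNone T ×ˢ S : Finset _) := by
    ext p
    constructor
    · rintro ⟨i, hi, s, hs, rfl⟩
      exact ⟨(i, s), by simpa using ⟨by simpa using hi, hs⟩, rfl⟩
    · rintro ⟨⟨i, s⟩, h, rfl⟩
      have h := Finset.mem_product.mp h
      exact ⟨i, h.1, s, h.2, rfl⟩
  rw [h, Set.InjOn.encard_image, Set.encard_coe_eq_coe_finsetCard, Finset.card_product,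
    Finset.card_insertNone]
  rintro ⟨i, s⟩ h1 ⟨j, s'⟩ h2 h
  have h1 := Finset.mem_product.mp h1
  have h2 := Finset.mem_product.mp h2
  have := (point_eq_iff (ne_some_zero hT h1.1) (ne_some_zero hT h2.1)).mp h
  exact Prod.ext this.1 this.2

/-- A line with three points on the quadric `xw = yz` lies in one of the two rulings. -/
lemma IsLine.eq_lineL_or_lineM {W : Submodule ℂ (Fin 4 → ℂ)} (hW : IsLine W)
    {t₁ t₂ t₃ s₁ s₂ s₃ : ℂ} (h₁ : vec (some t₁) s₁ ∈ W) (h₂ : vec (some t₂) s₂ ∈ W)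
    (h₃ : vec (some t₃) s₃ ∈ W) (h12 : point (some t₁) s₁ ≠ point (some t₂) s₂)
    (h13 : point (some t₁) s₁ ≠ point (some t₃) s₃)
    (h23 : point (some t₂) s₂ ≠ point (some t₃) s₃) :
    W = lineL t₁ ∨ W = lineM s₁ := by
  have hspan := hW.eq_span (linearIndependent_pair_of_mk_ne h12) h₁ h₂
  rw [← hspan, Submodule.mem_span_pair] at h₃
  obtain ⟨c, d, hcd⟩ := h₃
  have e0 := congrFun hcd 0
  have e1 := congrFun hcd 1
  have e2 := congrFun hcd 2
  have e3 := congrFun hcd 3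
  simp [vec] at e0 e1 e2 e3
  have hd : d = 1 - c := by linear_combination e0
  subst hd
  -- This is the equation xw = yz evaluated at the third point c v₁ + (1 - c) v₂, the first two
  -- points being on the quadric.
  have key : c * (1 - c) * (s₁ - s₂) * (t₁ - t₂) = 0 := by
    rw [← e1, ← e2] at e3
    linear_combination e3
  rcases mul_eq_zero.mp key with key | ht
  · rcases mul_eq_zero.mp key with key | hs
    · exfalso
      rcases mul_eq_zero.mp key with hc | hc
      · subst hc
        apply h23
        rw [← e1, ← e2]
        simp
      · obtain rfl : c = 1 := by linear_combination -hc
        apply h13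
        rw [← e1, ← e2]
        simp
    · right
      rw [sub_eq_zero] at hs
      subst hs
      exact hW.eq_of_mem (isLine_lineM _) h12 (point_mem_pointsOf.mpr h₁)
        (point_mem_pointsOf.mpr h₂)
        (point_mem_pointsOf.mpr (vec_mem_lineM_iff.mpr ⟨rfl, by simp⟩))
        (point_mem_pointsOf.mpr (vec_mem_lineM_iff.mpr ⟨rfl, by simp⟩))
  · left
    rw [sub_eq_zero] at ht
    subst ht
    exact hW.eq_of_mem (isLine_gridLine (some t₁)) h12 (point_mem_pointsOf.mpr h₁)
      (point_mem_pointsOf.mpr h₂) (point_mem_pointsOf.mpr (vec_mem_gridLine (some t₁) s₁))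
      (point_mem_pointsOf.mpr (vec_mem_gridLine (some t₁) s₂))

/-- The lines that contain at least four points of the set. -/
lemma eq_gridLine_or_lineM {T S : Finset ℂ} {W : Submodule ℂ (Fin 4 → ℂ)}
    (hW : IsLine W) (h4 : 4 ≤ (unionSet T S ∩ pointsOf W).encard) :
    (∃ i ∈ Finset.insertNone T, W = gridLine i) ∨ ∃ s ∈ S, W = lineM s := by
  set A : Set P3 := {p | p ∈ pointsOf W ∧ ∃ t ∈ T, ∃ s ∈ S, p = point (some t) s}
  set B : Set P3 := {p | p ∈ pointsOf W ∧ ∃ s ∈ S, p = point none s}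
  -- With at most one point on y = z = 0, at least three of the four points lie on the quadric. With
  -- two, W is the line y = z = 0.
  by_cases hB : B.encard ≤ 1
  · have hAB : unionSet T S ∩ pointsOf W ⊆ A ∪ B := by
      rintro _ ⟨⟨i, hi, s, hs, rfl⟩, hp⟩
      cases i with
      | none => exact Or.inr ⟨hp, s, hs, rfl⟩
      | some t => exact Or.inl ⟨hp, t, Finset.some_mem_insertNone.mp hi, s, hs, rfl⟩
    have h3 : 3 ≤ A.encard := by
      have h : (3 : ℕ∞) + 1 ≤ A.encard + 1 :=
        calc (3 : ℕ∞) + 1 = 4 := by norm_num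
          _ ≤ (A ∪ B).encard := h4.trans (Set.encard_le_encard hAB)
          _ ≤ A.encard + B.encard := Set.encard_union_le _ _
          _ ≤ A.encard + 1 := by gcongr
      exact (ENat.add_le_add_iff_right (by simp)).mp h
    obtain ⟨C, hCA, hC⟩ := Set.exists_subset_encard_eq h3
    obtain ⟨p, q, r, hpq, hpr, hqr, rfl⟩ := Set.encard_eq_three.mp hC
    obtain ⟨hp, t₁, ht₁, s₁, hs₁, rfl⟩ := hCA (by simp : p ∈ _)
    obtain ⟨hq, t₂, ht₂, s₂, hs₂, rfl⟩ := hCA (by simp : q ∈ _)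
    obtain ⟨hr, t₃, ht₃, s₃, hs₃, rfl⟩ := hCA (by simp : r ∈ _)
    rcases hW.eq_lineL_or_lineM (point_mem_pointsOf.mp hp) (point_mem_pointsOf.mp hq)
      (point_mem_pointsOf.mp hr) hpq hpr hqr with h | h
    · exact Or.inl ⟨some t₁, Finset.some_mem_insertNone.mpr ht₁, h⟩
    · exact Or.inr ⟨s₁, hs₁, h⟩
  · obtain ⟨p, q, ⟨hp, s, _, rfl⟩, ⟨hq, s', _, rfl⟩, hne⟩ :=
      Set.one_lt_encard_iff.mp (not_le.mp hB)
    exact Or.inl ⟨none, Finset.none_mem_insertNone, hW.eq_of_mem (isLine_gridLine none) hne hp hq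
      (point_mem_pointsOf.mpr (vec_mem_gridLine _ _))
      (point_mem_pointsOf.mpr (vec_mem_gridLine _ _))⟩

/-- The lines with index in `insertNone T` carry |S| points. A line `lineM s` carries |T| points if
s ≠ 0, since it then misses y = z = 0, and |T| + 1 if s = 0. Excluding k = |T| leaves only `lineM 0`
from the second ruling. -/
lemma setOf_lines_eq {T S : Finset ℂ} (hT : ∀ t ∈ T, t ≠ 0) {k : ℕ} (hk : 4 ≤ k)
    (hkT : k ≠ T.card) :
    {W | IsLine W ∧ (unionSet T S ∩ pointsOf W).encard = k} =
      {W | (k = S.card ∧ W ∈ gridLine '' Finset.insertNone T) ∨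
        (0 ∈ S ∧ k = T.card + 1 ∧ W = lineM 0)} := by
  ext W
  constructor
  · rintro ⟨hW, hWk⟩
    rcases eq_gridLine_or_lineM hW (by rw [hWk]; exact_mod_cast hk) with ⟨i, hi, rfl⟩ | ⟨s, hs, rfl⟩
    · rw [encard_inter_gridLine hT hi] at hWk
      exact Or.inl ⟨by exact_mod_cast hWk.symm, i, hi, rfl⟩
    · by_cases hs0 : s = 0
      · subst hs0
        rw [encard_inter_lineM_zero hT hs] at hWk
        exact Or.inr ⟨hs, by exact_mod_cast hWk.symm, rfl⟩
      · rw [encard_inter_lineM hT hs hs0] at hWk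
        exact absurd (by exact_mod_cast hWk.symm) hkT
  · rintro (⟨rfl, i, hi, rfl⟩ | ⟨hS, rfl, rfl⟩)
    · exact ⟨isLine_gridLine i, encard_inter_gridLine hT hi⟩
    · exact ⟨isLine_lineM 0, encard_inter_lineM_zero hT hS⟩

lemma encard_image_gridLine {T : Finset ℂ} (hT : ∀ t ∈ T, t ≠ 0) :
    (gridLine '' Finset.insertNone T).encard = (T.card + 1 : ℕ) := by
  rw [(gridLine_injOn hT).encard_image, Set.encard_coe_eq_coe_finsetCard, Finset.card_insertNone]

lemma numLines_of_ne {T S : Finset ℂ} (hT : ∀ t ∈ T, t ≠ 0) {k : ℕ} (hk : 4 ≤ k)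
    (hkT : k ≠ T.card) (hkS : k ≠ S.card) (h0 : 0 ∉ S) : numLines (unionSet T S) k = 0 := by
  rw [numLines, setOf_lines_eq hT hk hkT, Set.encard_eq_zero]
  simp [hkS, h0]

lemma numLines_card {T S : Finset ℂ} (hT : ∀ t ∈ T, t ≠ 0) (hk : 4 ≤ S.card)
    (hkT : S.card ≠ T.card) (h0 : 0 ∈ S → S.card ≠ T.card + 1) :
    numLines (unionSet T S) S.card = (T.card + 1 : ℕ) := by
  rw [numLines, setOf_lines_eq hT hk hkT, ← encard_image_gridLine hT]
  congr 1
  ext W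
  constructor
  · rintro (⟨-, h⟩ | ⟨hS, h, -⟩)
    · exact h
    · exact absurd h (h0 hS)
  · exact fun h => Or.inl ⟨rfl, h⟩

lemma numLines_eq_one {T S : Finset ℂ} (hT : ∀ t ∈ T, t ≠ 0) (hk : 4 ≤ T.card + 1)
    (hkS : T.card + 1 ≠ S.card) (h0 : 0 ∈ S) : numLines (unionSet T S) (T.card + 1) = 1 := by
  rw [numLines, setOf_lines_eq hT hk (by omega), Set.encard_eq_one]
  exact ⟨lineM 0, by ext W; simp [hkS, h0]⟩

lemma numLines_eq_add_one {T S : Finset ℂ} (hT : ∀ t ∈ T, t ≠ 0) (hk : 4 ≤ T.card + 1)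
    (hkS : T.card + 1 = S.card) (h0 : 0 ∈ S) :
    numLines (unionSet T S) (T.card + 1) = (T.card + 1 + 1 : ℕ) := by
  have h : {W | (T.card + 1 = S.card ∧ W ∈ gridLine '' Finset.insertNone T) ∨
      (0 ∈ S ∧ T.card + 1 = T.card + 1 ∧ W = lineM 0)} =
      insert (lineM 0) (gridLine '' Finset.insertNone T) := by
    ext W
    simp only [hkS, h0, true_and, Set.mem_insert_iff, Set.mem_ofPred_eq]
    exact or_comm
  rw [numLines, setOf_lines_eq hT hk (by omega), h, Set.encard_insert_of_notMem,
    encard_image_gridLine hT]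
  · norm_cast
  · rintro ⟨i, _, hi⟩
    exact gridLine_ne_lineM i 0 hi

/-! ### Nondegeneracy, and failure to be a grid -/

lemma nondegenerate_unionSet {T S : Finset ℂ} (hT : 1 < T.card) (hS : 1 < S.card) :
    Nondegenerate (unionSet T S) := by
  obtain ⟨t₁, ht₁, t₂, ht₂, ht⟩ := Finset.one_lt_card.mp hT
  obtain ⟨s₁, hs₁, s₂, hs₂, hs⟩ := Finset.one_lt_card.mp hS
  intro W hW hsub
  have hlt : W < ⊤ := by
    apply Submodule.lt_top_of_finrank_lt_finrank
    rw [hW]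
    simp
  obtain ⟨f, hf, hWf⟩ := W.exists_le_ker_of_lt_top hlt
  -- On the grid the equation of a plane is a polynomial of degree at most one in each of s and t,
  -- so its zeros at a 2 × 2 subgrid make it vanish.
  have hmem : ∀ t ∈ T, ∀ s ∈ S, f (Pi.single 0 1) + t * f (Pi.single 1 1) +
      s * f (Pi.single 2 1) + s * t * f (Pi.single 3 1) = 0 := by
    intro t ht s hs
    have h := hWf (point_mem_pointsOf.mp
      (hsub ⟨some t, Finset.some_mem_insertNone.mpr ht, s, hs, rfl⟩))
    rw [LinearMap.mem_ker, pi_eq_sum_univ' (vec (some t) s)] at h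
    simpa [Fin.sum_univ_four, vec] using h
  have h11 := hmem t₁ ht₁ s₁ hs₁
  have h12 := hmem t₁ ht₁ s₂ hs₂
  have h21 := hmem t₂ ht₂ s₁ hs₁
  have h22 := hmem t₂ ht₂ s₂ hs₂
  have ht' := sub_ne_zero.mpr ht
  have hs' := sub_ne_zero.mpr hs
  have h3 : f (Pi.single 3 1) = 0 := by
    apply mul_left_cancel₀ (mul_ne_zero ht' hs')
    linear_combination h11 - h12 - h21 + h22
  have h2 : f (Pi.single 2 1) = 0 := by
    apply mul_left_cancel₀ hs'
    linear_combination h11 - h12 - (s₁ - s₂) * t₁ * h3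
  have h1 : f (Pi.single 1 1) = 0 := by
    apply mul_left_cancel₀ ht'
    linear_combination h11 - h21 - (t₁ - t₂) * s₁ * h3
  have h0 : f (Pi.single 0 1) = 0 := by
    linear_combination h11 - t₁ * h1 - s₁ * h2 - s₁ * t₁ * h3
  apply hf
  ext k
  fin_cases k
  · simpa using h0
  · simpa using h1
  · simpa using h2
  · simpa using h3

/-- The only line with four points of the set through a point of `y = z = 0` off the quadric is
`y = z = 0`. -/
lemma eq_gridLine_none {T S : Finset ℂ} (hT : ∀ t ∈ T, t ≠ 0) {W : Submodule ℂ (Fin 4 → ℂ)}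
    (hW : IsLine W) (h4 : 4 ≤ (unionSet T S ∩ pointsOf W).encard) {s : ℂ} (hs : s ≠ 0)
    (hmem : point none s ∈ pointsOf W) : W = gridLine none := by
  rw [point_mem_pointsOf] at hmem
  rcases eq_gridLine_or_lineM hW h4 with ⟨i, hi, rfl⟩ | ⟨s', _, rfl⟩
  · rw [vec_mem_gridLine_iff (ne_some_zero hT hi) (by simp)] at hmem
    rw [hmem]
  · rw [vec_mem_lineM_iff] at hmem
    exact absurd (hmem.1.trans (hmem.2 rfl)) hs

lemma IsGrid.encard_le {c d : ℕ} {Z : Set P3}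
    {A : Fin c → Submodule ℂ (Fin 4 → ℂ)} {B : Fin d → Submodule ℂ (Fin 4 → ℂ)}
    (hAB : ∀ i j, ∃! p, p ∈ pointsOf (A i) ∩ pointsOf (B j))
    (hZ : Z = (⋃ i, pointsOf (A i)) ∩ ⋃ j, pointsOf (B j)) : Z.encard ≤ (c * d : ℕ) := by
  choose p hp hp' using hAB
  have hsub : Z ⊆ (fun x : Fin c × Fin d => p x.1 x.2) '' (Finset.univ : Finset (Fin c × Fin d)) := by
    rw [hZ]
    rintro q ⟨hA, hB⟩
    obtain ⟨i, hi⟩ := Set.mem_iUnion.mp hA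
    obtain ⟨j, hj⟩ := Set.mem_iUnion.mp hB
    exact ⟨(i, j), by simp, (hp' i j q ⟨hi, hj⟩).symm⟩
  refine (Set.encard_le_encard hsub).trans ((Set.encard_image_le _ _).trans ?_)
  rw [Set.encard_coe_eq_coe_finsetCard]
  simp

lemma IsGrid.encard_inter {c d : ℕ} {Z : Set P3}
    {A : Fin c → Submodule ℂ (Fin 4 → ℂ)} {B : Fin d → Submodule ℂ (Fin 4 → ℂ)}
    (hB : ∀ j j', j ≠ j' → Disjoint (pointsOf (B j)) (pointsOf (B j')))
    (hAB : ∀ i j, ∃! p, p ∈ pointsOf (A i) ∩ pointsOf (B j))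
    (hZ : Z = (⋃ i, pointsOf (A i)) ∩ ⋃ j, pointsOf (B j)) (i : Fin c) :
    (Z ∩ pointsOf (A i)).encard = d := by
  choose p hp hp' using hAB
  have h : Z ∩ pointsOf (A i) = p i '' (Finset.univ : Finset (Fin d)) := by
    ext q
    constructor
    · rintro ⟨hq, hA⟩
      rw [hZ] at hq
      obtain ⟨j, hj⟩ := Set.mem_iUnion.mp hq.2
      exact ⟨j, by simp, (hp' i j q ⟨hA, hj⟩).symm⟩
    · rintro ⟨j, _, rfl⟩
      refine ⟨?_, (hp i j).1⟩
      rw [hZ]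
      exact ⟨Set.mem_iUnion.mpr ⟨i, (hp i j).1⟩, Set.mem_iUnion.mpr ⟨j, (hp i j).2⟩⟩
  rw [h, Set.InjOn.encard_image, Set.encard_coe_eq_coe_finsetCard]
  · simp
  · intro j _ j' _ hjj
    by_contra hne
    refine Set.disjoint_left.mp (hB j j' hne) (hp i j).2 ?_
    rw [hjj]
    exact (hp i j').2

/-- Through a point of a grid with c, d ≥ 4 there pass two distinct lines with at least four points
each. A point of y = z = 0 with parameter s ≠ 0 lies on only one such line. Counting points gives
first d ≥ 4, then d = |S|, and only then c ≥ |T| + 1 ≥ 4. -/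
lemma not_isGrid_unionSet {T S : Finset ℂ} (hT : ∀ t ∈ T, t ≠ 0) (hTc : 3 ≤ T.card)
    (hSc : 4 ≤ S.card) (c d : ℕ) : ¬ IsGrid c d (unionSet T S) := by
  rintro ⟨_, hcd, A, B, hA, hB, hAd, hBd, hAB, hZ⟩
  obtain ⟨s, hs, hs0⟩ : ∃ s ∈ S, s ≠ 0 :=
    Finset.exists_mem_ne (by omega) 0
  have hy : point none s ∈ unionSet T S := ⟨none, Finset.none_mem_insertNone, s, hs, rfl⟩
  have hy' := hy
  rw [hZ] at hy'
  obtain ⟨i, hi⟩ := Set.mem_iUnion.mp hy'.1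
  obtain ⟨j, hj⟩ := Set.mem_iUnion.mp hy'.2
  have hle := IsGrid.encard_le hAB hZ
  rw [encard_unionSet hT] at hle
  have hle : (T.card + 1) * S.card ≤ c * d := by exact_mod_cast hle
  have hd : 4 ≤ d := by nlinarith
  have hAi := IsGrid.encard_inter hBd hAB hZ i
  have hAe := eq_gridLine_none hT (hA i) (by rw [hAi]; exact_mod_cast hd) hs0 hi
  have hdS : d = S.card := by
    rw [hAe, encard_inter_gridLine hT Finset.none_mem_insertNone] at hAi
    exact_mod_cast hAi.symm
  have hc : 4 ≤ c := by
    rw [hdS] at hle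
    have := Nat.le_of_mul_le_mul_right hle (by omega)
    omega
  have hBj : (unionSet T S ∩ pointsOf (B j)).encard = c :=
    IsGrid.encard_inter hAd (fun j i => by simpa [Set.inter_comm] using hAB i j)
      (by rw [hZ, Set.inter_comm]) j
  have hBe := eq_gridLine_none hT (hB j) (by rw [hBj]; exact_mod_cast hc) hs0 hj
  obtain ⟨s', hs', hss⟩ : ∃ s' ∈ S, s' ≠ s := Finset.exists_mem_ne (by omega) s
  obtain ⟨p, _, hp⟩ := hAB i j
  rw [hAe, hBe] at hp
  have hk : ∀ u, point none u ∈ pointsOf (gridLine none) := fun u =>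
    point_mem_pointsOf.mpr (vec_mem_gridLine none u)
  have := (hp _ ⟨hk s', hk s'⟩).trans (hp _ ⟨hk s, hk s⟩).symm
  exact hss ((point_eq_iff (by simp) (by simp)).mp this).2

/-! ### Line counts under combinatorial and projective equivalence -/

lemma coe_span_pair {p q : P3} :
    (Projectivization.Subspace.span {p, q} : Set P3) =
      pointsOf (Submodule.span ℂ {p.rep, q.rep}) := by
  set W : Submodule ℂ (Fin 4 → ℂ) := Submodule.span ℂ {p.rep, q.rep}
  have h : Projectivization.Subspace.span {p, q} = W.projectivization := by
    apply le_antisymm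
    · rw [Projectivization.Subspace.span_le_subspace_iff, Set.pair_subset_iff]
      constructor
      · exact (Submodule.mem_projectivization_iff_submodule_le _ _).mpr
          (mem_pointsOf_iff_rep.mpr (Submodule.subset_span (by simp)))
      · exact (Submodule.mem_projectivization_iff_submodule_le _ _).mpr
          (mem_pointsOf_iff_rep.mpr (Submodule.subset_span (by simp)))
    · rw [OrderIso.symm_apply_le, Submodule.span_le, Set.pair_subset_iff]
      have h := Projectivization.Subspace.subset_span ({p, q} : Set P3)
      constructor
      · rw [SetLike.mem_coe, Projectivization.Subspace.mem_submodule_iff _ p.rep_nonzero, p.mk_rep]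
        exact h (by simp)
      · rw [SetLike.mem_coe, Projectivization.Subspace.mem_submodule_iff _ q.rep_nonzero, q.mk_rep]
        exact h (by simp)
  rw [h]
  ext r
  exact Submodule.mem_projectivization_iff_submodule_le _ _

/-- If the lines with `k ≥ 2` points of `Z₂` are the images of lines with `k` points of `Z₁`, then
`Z₁` has at least as many of them. -/
lemma numLines_le_of_image {Z₁ Z₂ : Set P3} {k : ℕ} (hk : 2 ≤ k) (f : P3 → P3)
    (hf : Set.InjOn f Z₁)
    (h : ∀ W', IsLine W' → (Z₂ ∩ pointsOf W').encard = k →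
      ∃ W, IsLine W ∧ f '' (Z₁ ∩ pointsOf W) = Z₂ ∩ pointsOf W') :
    numLines Z₂ k ≤ numLines Z₁ k := by
  choose! g hg hgf using h
  apply Set.encard_le_encard_of_injOn (f := g)
  · rintro W' ⟨hW', hk'⟩
    refine ⟨hg W' hW' hk', ?_⟩
    rw [← (hf.mono Set.inter_subset_left).encard_image, hgf W' hW' hk', hk']
  -- The line W' is recovered from its k ≥ 2 points, which are the images of the points on the
  -- chosen line.
  · rintro W' ⟨hW', hk'⟩ W'' ⟨hW'', hk''⟩ hWW
    have h1 := hgf W' hW' hk'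
    rw [hWW, hgf W'' hW'' hk''] at h1
    have h2 : 1 < (Z₂ ∩ pointsOf W').encard := by
      rw [hk']
      exact_mod_cast hk
    obtain ⟨p, q, hp, hq, hpq⟩ := Set.one_lt_encard_iff.mp h2
    have hp' := hp
    have hq' := hq
    rw [← h1] at hp' hq'
    exact hW'.eq_of_mem hW'' hpq hp.2 hq.2 hp'.2 hq'.2

/-- Only spans of two points matter: a line with k points of Z₂ is spanned by f(p) and f(q), and it
corresponds to the line spanned by p and q. -/
lemma CombEquiv.numLines_le {Z₁ Z₂ : Set P3} (h : CombEquiv Z₁ Z₂) {k : ℕ} (hk : 2 ≤ k) :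
    numLines Z₂ k ≤ numLines Z₁ k := by
  obtain ⟨f, hf, hS⟩ := h
  refine numLines_le_of_image hk f hf.injOn fun W' hW' hk' => ?_
  have h2 : 1 < (Z₂ ∩ pointsOf W').encard := by
    rw [hk']
    exact_mod_cast hk
  obtain ⟨p', q', hp', hq', hpq⟩ := Set.one_lt_encard_iff.mp h2
  obtain ⟨p, hp, rfl⟩ := hf.surjOn hp'.1
  obtain ⟨q, hq, rfl⟩ := hf.surjOn hq'.1
  have hne : p ≠ q := fun h => hpq (by rw [h])
  refine ⟨_, isLine_span_pair (linearIndependent_rep hne), ?_⟩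
  have := (hS {p, q} (Set.pair_subset_iff.mpr ⟨hp, hq⟩)).image_eq
  rw [Set.image_pair, coe_span_pair, coe_span_pair,
    hW'.eq_span (linearIndependent_rep hpq) (mem_pointsOf_iff_rep.mp hp'.2)
      (mem_pointsOf_iff_rep.mp hq'.2)] at this
  rw [Set.inter_comm, this, Set.inter_comm]

lemma ProjEquiv.numLines_le {Z₁ Z₂ : Set P3} (h : ProjEquiv Z₁ Z₂) {k : ℕ} (hk : 2 ≤ k) :
    numLines Z₂ k ≤ numLines Z₁ k := by
  obtain ⟨g, rfl⟩ := h
  refine numLines_le_of_image hk _ (Projectivization.map_injective _ g.injective).injOn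
    fun W' hW' _ => ⟨W'.comap g.toLinearMap, ?_, ?_⟩
  · rw [IsLine, Submodule.comap_equiv_eq_map_symm, LinearEquiv.finrank_map_eq]
    exact hW'
  · have h : ∀ p : P3, p ∈ pointsOf (W'.comap g.toLinearMap) ↔
        Projectivization.map g.toLinearMap g.injective p ∈ pointsOf W' := by
      intro p
      induction p using Projectivization.ind with
      | h v hv =>
        rw [Projectivization.map_mk, mk_mem_pointsOf, mk_mem_pointsOf, Submodule.mem_comap]
    ext q
    constructor
    · rintro ⟨p, ⟨hp, hpW⟩, rfl⟩
      exact ⟨⟨p, hp, rfl⟩, (h p).mp hpW⟩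
    · rintro ⟨⟨p, hp, rfl⟩, hpW⟩
      exact ⟨p, ⟨hp, (h p).mpr hpW⟩, rfl⟩

/-! ### Comparison with the standard and extended constructions -/

lemma pt_mem_lineL {t y z w : ℂ} : pt y z w ∈ pointsOf (lineL t) ↔ y = t ∧ w = t * z := by
  rw [pt, mk_mem_pointsOf, mem_lineL]
  simp

lemma mem_unionSet {T S : Finset ℂ} {p : P3} : p ∈ unionSet T S ↔
    (∃ t ∈ T, ∃ s ∈ S, p = pt t s (s * t)) ∨ ∃ s ∈ S, p = pt 0 0 (-s) := by
  constructor
  · rintro ⟨i, hi, s, hs, rfl⟩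
    cases i with
    | none => exact Or.inr ⟨s, hs, rfl⟩
    | some t => exact Or.inl ⟨t, Finset.some_mem_insertNone.mp hi, s, hs, rfl⟩
  · rintro (⟨t, ht, s, hs, rfl⟩ | ⟨s, hs, rfl⟩)
    · exact ⟨some t, Finset.some_mem_insertNone.mpr ht, s, hs, rfl⟩
    · exact ⟨none, Finset.none_mem_insertNone, s, hs, rfl⟩

lemma standardSet_eq {n : ℕ} (hn : 0 < n) : standardSet n =
    unionSet (Polynomial.nthRootsFinset n 1) (Polynomial.nthRootsFinset n 1) := by
  ext p
  rw [mem_unionSet]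
  simp only [Polynomial.mem_nthRootsFinset hn]
  constructor
  · rintro (⟨s, t, hs, ht, rfl⟩ | h)
    · exact Or.inl ⟨t, ht, s, hs, rfl⟩
    · exact Or.inr h
  · rintro (⟨t, ht, s, hs, rfl⟩ | h)
    · exact Or.inl ⟨s, t, hs, ht, rfl⟩
    · exact Or.inr h

lemma extendedSet_eq {n : ℕ} (hn : 0 < n) : extendedSet n =
    unionSet (Polynomial.nthRootsFinset n 1) (Polynomial.nthRootsFinset n 1 ∪ {0}) := by
  ext p
  rw [extendedSet, standardSet_eq hn, Set.mem_union, mem_unionSet, mem_unionSet]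
  simp only [Finset.mem_union, Finset.mem_singleton, Polynomial.mem_nthRootsFinset hn]
  constructor
  · rintro ((⟨t, ht, s, hs, rfl⟩ | ⟨s, hs, rfl⟩) | (rfl | ⟨t, ht, rfl⟩))
    · exact Or.inl ⟨t, ht, s, Or.inl hs, rfl⟩
    · exact Or.inr ⟨s, Or.inl hs, rfl⟩
    · exact Or.inr ⟨0, Or.inr rfl, by simp⟩
    · exact Or.inl ⟨t, ht, 0, Or.inr rfl, by simp⟩
  · rintro (⟨t, ht, s, hs | rfl, rfl⟩ | ⟨s, hs | rfl, rfl⟩)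
    · exact Or.inl (Or.inl ⟨t, ht, s, hs, rfl⟩)
    · exact Or.inr (Or.inr ⟨t, ht, by simp⟩)
    · exact Or.inl (Or.inr ⟨s, hs, rfl⟩)
    · exact Or.inr (Or.inl (by simp))

/-- For t ≠ 0 the line `lineL t` misses y = z = 0, so the removal leaves the points of that line
untouched. -/
lemma unionSet_sdiff {T S U : Finset ℂ} (hU : ∀ t ∈ U, t ≠ 0) (hTU : T ⊆ U) :
    unionSet T S = unionSet U S \ ⋃ t ∈ U \ T, pointsOf (lineL t) := by
  ext p
  simp only [Set.mem_sdiff, mem_unionSet, Set.mem_iUnion, not_exists, Finset.mem_sdiff]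
  constructor
  · rintro (⟨t, ht, s, hs, rfl⟩ | ⟨s, hs, rfl⟩)
    · refine ⟨Or.inl ⟨t, hTU ht, s, hs, rfl⟩, fun t' ht' h => ?_⟩
      rw [pt_mem_lineL] at h
      exact ht'.2 (h.1 ▸ ht)
    · refine ⟨Or.inr ⟨s, hs, rfl⟩, fun t' ht' h => ?_⟩
      rw [pt_mem_lineL] at h
      exact hU t' ht'.1 h.1.symm
  · rintro ⟨⟨t, ht, s, hs, rfl⟩ | h, hne⟩
    · refine Or.inl ⟨t, ?_, s, hs, rfl⟩
      by_contra htT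
      exact hne t ⟨ht, htT⟩ (pt_mem_lineL.mpr ⟨rfl, mul_comm _ _⟩)
    · exact Or.inr h

end Geproci

theorem corollaryc (a b : ℕ) (ha : 4 ≤ a) (hab : a ≤ b) :
    ∃ Z₁ Z₂ : Set Geproci.P3,
      Geproci.IsNontrivialGeproci a b Z₁ ∧ Geproci.IsNontrivialGeproci a b Z₂ ∧
      Geproci.FromStandardConstruction a b Z₁ ∧ Geproci.FromExtendedConstruction a b Z₂ ∧
      (a < b →
        Geproci.numLines Z₁ a = 0 ∧ Geproci.numLines Z₁ b = a ∧
        Geproci.numLines Z₂ a = 1 ∧ Geproci.numLines Z₂ b = a) ∧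
      (a = b → Geproci.numLines Z₁ b = b ∧ Geproci.numLines Z₂ b = b + 1) ∧
      ¬ Geproci.CombEquiv Z₁ Z₂ ∧ ¬ Geproci.ProjEquiv Z₁ Z₂ := by
  open Geproci in
  obtain ⟨m, rfl⟩ : ∃ m, a = m + 1 := ⟨a - 1, by omega⟩
  obtain ⟨n, rfl⟩ : ∃ n, b = n + 1 := ⟨b - 1, by omega⟩
  have hcard : ∀ k, 0 < k → (Polynomial.nthRootsFinset k (1 : ℂ)).card = k := fun k hk =>
    (Complex.isPrimitiveRoot_exp k hk.ne').card_nthRootsFinset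
  have hne : ∀ k, 0 < k → ∀ t ∈ Polynomial.nthRootsFinset k (1 : ℂ), t ≠ 0 := by
    intro k hk t ht h
    rw [Polynomial.mem_nthRootsFinset hk, h] at ht
    simp [hk.ne'] at ht
  have hn : 0 < n := by omega
  have hn1 : 0 < n + 1 := by omega
  set S₁ := Polynomial.nthRootsFinset (n + 1) (1 : ℂ) with hS₁
  set U := Polynomial.nthRootsFinset n (1 : ℂ) with hU
  set S₂ := U ∪ {0} with hS₂
  have h0S₁ : 0 ∉ S₁ := fun h => hne _ hn1 0 h rfl
  have h0S₂ : 0 ∈ S₂ := by simp [hS₂]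
  have hS₁c : S₁.card = n + 1 := hcard _ hn1
  have hUc : U.card = n := hcard _ hn
  have hS₂c : S₂.card = n + 1 := by
    rw [hS₂, Finset.card_union_of_disjoint, hUc, Finset.card_singleton]
    rw [Finset.disjoint_singleton_right]
    exact fun h => hne _ hn 0 h rfl
  obtain ⟨T₁, hT₁, hT₁c⟩ := Finset.exists_subset_card_eq (s := S₁) (n := m) (by omega)
  obtain ⟨T₂, hT₂, hT₂c⟩ := Finset.exists_subset_card_eq (s := U) (n := m) (by omega)
  have hT₁0 : ∀ t ∈ T₁, t ≠ 0 := fun t ht => hne _ hn1 t (hT₁ ht)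
  have hT₂0 : ∀ t ∈ T₂, t ≠ 0 := fun t ht => hne _ hn t (hT₂ ht)
  have hg₁ : IsGeproci (m + 1) (n + 1) (unionSet T₁ S₁) := by
    have := isGeproci_unionSet hn1 (E := ∅) (by simp) hT₁ (by
      rw [Finset.union_empty, ← hS₁]; omega)
    rwa [Finset.union_empty, ← hS₁, hS₁c, hT₁c] at this
  have hg₂ : IsGeproci (m + 1) (n + 1) (unionSet T₂ S₂) := by
    have := isGeproci_unionSet hn (E := {0}) (by simp) hT₂ (by
      rw [← hU, ← hS₂]; omega)
    rwa [← hU, ← hS₂, hS₂c, hT₂c] at this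
  have hlt : m < n → numLines (unionSet T₁ S₁) (m + 1) = 0 ∧
      numLines (unionSet T₂ S₂) (m + 1) = 1 := by
    intro hmn
    refine ⟨numLines_of_ne hT₁0 ha (by omega) (by omega) h0S₁, ?_⟩
    have := numLines_eq_one hT₂0 (by omega) (by omega) h0S₂
    rwa [hT₂c] at this
  have h1 : numLines (unionSet T₁ S₁) (n + 1) = (m + 1 : ℕ) := by
    have := numLines_card hT₁0 (S := S₁) (by omega) (by omega) (fun h => absurd h h0S₁)
    rwa [hS₁c, hT₁c] at this
  have heq : m = n → numLines (unionSet T₂ S₂) (m + 1) = (m + 1 + 1 : ℕ) := by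
    intro hmn
    have := numLines_eq_add_one hT₂0 (by omega) (by omega) h0S₂
    rwa [hT₂c] at this
  -- The number of lines with exactly a = m + 1 points separates the sets in both cases. One strict
  -- inequality is enough to rule out each equivalence.
  have hnot : ¬ numLines (unionSet T₂ S₂) (m + 1) ≤ numLines (unionSet T₁ S₁) (m + 1) := by
    rcases Nat.lt_or_ge m n with hmn | hmn
    · rw [(hlt hmn).1, (hlt hmn).2]
      simp
    · obtain rfl : m = n := by omega
      rw [heq rfl, h1]
      norm_cast
      omega
  refine ⟨unionSet T₁ S₁, unionSet T₂ S₂,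
    ⟨hg₁, nondegenerate_unionSet (by omega) (by omega),
      not_isGrid_unionSet hT₁0 (by omega) (by omega)⟩,
    ⟨hg₂, nondegenerate_unionSet (by omega) (by omega),
      not_isGrid_unionSet hT₂0 (by omega) (by omega)⟩,
    ⟨S₁ \ T₁, ?_, ?_, ?_⟩, ⟨U \ T₂, ?_, ?_, ?_⟩, ?_, ?_,
    fun h => hnot (h.numLines_le (by omega)), fun h => hnot (h.numLines_le (by omega))⟩
  · rw [Finset.card_sdiff_of_subset hT₁]
    omega
  · intro t ht
    exact (Polynomial.mem_nthRootsFinset hn1 _).mp (Finset.mem_sdiff.mp ht).1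
  · rw [standardSet_eq hn1]
    exact unionSet_sdiff (hne _ hn1) hT₁
  · rw [Finset.card_sdiff_of_subset hT₂]
    omega
  · intro t ht
    exact (Polynomial.mem_nthRootsFinset hn _).mp (Finset.mem_sdiff.mp ht).1
  · rw [Nat.add_sub_cancel, extendedSet_eq hn]
    exact unionSet_sdiff (hne _ hn) hT₂
  · intro hmn
    refine ⟨(hlt (by omega)).1, h1, (hlt (by omega)).2, ?_⟩
    have := numLines_card hT₂0 (S := S₂) (by omega) (by omega) (fun _ => by omega)
    rwa [hS₂c, hT₂c] at this
  · intro hmn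
    obtain rfl : m = n := by omega
    exact ⟨h1, by rw [heq rfl]; norm_cast⟩
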